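/- Let $\mathcal X_1,\mathcal X_2,\mathcal Z$ be finite alphabets, let $W_{Z|X_1X_2}$ be a channel transition probability from $\mathcal X_1\times\mathcal X_2$ to $\mathcal Z$, and let $Q_Z$ be a probability distribution on $\mathcal Z$. All logarithms are to base 2. A code of block length $n$ and rates $R_1,R_2\ge 0$ for the multiple-access channel with non-causal cribbing consists of deterministic per-symbol encoding maps $$f_{1i}:\mathcal M_1\to\mathcal X_1,\qquad f_{2i}:\mathcal M_2\times\mathcal X_1^n\to\mathcal X_2\qquad(1\le i\le n),$$ where $\mathcal M_k=\{1,\dots,\lfloor 2^{nR_k}\rfloor\}$ for $k=1,2$. The messages $M_1,M_2$ are independent and uniform on $\mathcal M_1,\mathcal M_2$. Encoder 1 sends $X_1^n=(f_{11}(M_1),\dots,f_{1n}(M_1))$; Encoder 2 sees this whole codeword and sends $X_2^n=(f_{21}(M_2,X_1^n),\dots,f_{2n}(M_2,X_1^n))$. The output $Z^n$ is produced by $n$ independent uses of $W$, and $P_{Z^n}$ is its distribution. A pair $(R_1,R_2)$ with $R_1,R_2\ge 0$ is called achievable for $Q_Z$ if there is a sequence of such codes, one for each $n$, with $$\lim_{n\to\infty}\mathbb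 D\big(P_{Z^n}\,\big\|\,Q_Z^{\otimes n}\big)=0,$$ where $\mathbb D$ is the (unnormalized) Kullback–Leibler divergence, equal to $+\infty$ when absolute continuity fails. The resolvability region is the closure in $\mathbb R^2$ of the set of achievable pairs. Theorem. The resolvability region of the multiple-access channel with non-causal cribbing for the target $Q_Z$ is exactly the set of pairs $(R_1,R_2)$ with $R_1,R_2\ge 0$ such that $$R_1\ge I(X_1;Z),\qquad R_2\ge I(X_1,X_2;Z)-H(X_1),\qquad R_1+R_2\ge I(X_1,X_2;Z)$$ for some joint distribution $P_{X_1X_2Z}=P_{X_1X_2}W_{Z|X_1X_2}$ whose marginal on $\mathcal Z$ is $Q_Z$. -/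

import Mathlib

noncomputable section

namespace CribbingMAC

/-- Kullback-Leibler divergence, in bits, of two distributions on a finite alphabet; it is `+∞`
when `P` charges a letter that `Q` does not. Terms with `P x = 0` contribute `0`. -/
def kl {A : Type*} [Fintype A] (P Q : A → ℝ) : EReal :=
  open Classical in
  if ∀ x, Q x = 0 → P x = 0 then ((∑ x, P x * Real.logb 2 (P x / Q x) : ℝ) : EReal) else ⊤

/-- Shannon entropy in bits (`0 log 0 = 0`). -/
def entropy {A : Type*} [Fintype A] (P : A → ℝ) : ℝ :=
  -∑ x, P x * Real.logb 2 (P x)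

/-- First marginal of a distribution on a product alphabet. -/
def fstMarginal {A B : Type*} [Fintype B] (P : A × B → ℝ) (a : A) : ℝ := ∑ b, P (a, b)

/-- Second marginal of a distribution on a product alphabet. -/
def sndMarginal {A B : Type*} [Fintype A] (P : A × B → ℝ) (b : B) : ℝ := ∑ a, P (a, b)

/-- Mutual information `I(A; B)` in bits of a pair with joint distribution `P`; terms with
`P (a, b) = 0` contribute `0`, and the denominator is nonzero in all other terms. -/
def mutualInfo {A B : Type*} [Fintype A] [Fintype B] (P : A × B → ℝ) : ℝ :=
  ∑ a, ∑ b, P (a, b) * Real.logb 2 (P (a, b) / (fstMarginal P a * sndMarginal P b))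

/-- The `n`-fold product distribution `Q^{⊗ n}`. -/
def iidDist {A : Type*} (n : ℕ) (Q : A → ℝ) (z : Fin n → A) : ℝ := ∏ i, Q (z i)

/-- `W` is a channel transition probability: `W x₁ x₂ z = W(z | x₁, x₂)`. -/
def IsChannel {X₁ X₂ Z : Type*} [Fintype Z] (W : X₁ → X₂ → Z → ℝ) : Prop :=
  ∀ x₁ x₂, W x₁ x₂ ∈ stdSimplex ℝ Z

/-- The joint distribution `P_{X₁X₂} W_{Z|X₁X₂}` of `((X₁, X₂), Z)`. -/
def jointDist {X₁ X₂ Z : Type*} (P : X₁ × X₂ → ℝ) (W : X₁ → X₂ → Z → ℝ) :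
    (X₁ × X₂) × Z → ℝ :=
  fun q => P q.1 * W q.1.1 q.1.2 q.2

/-- The joint distribution of `(X₁, Z)` under `P_{X₁X₂} W_{Z|X₁X₂}`. -/
def jointDistFst {X₁ X₂ Z : Type*} [Fintype X₂] (P : X₁ × X₂ → ℝ) (W : X₁ → X₂ → Z → ℝ) :
    X₁ × Z → ℝ :=
  fun q => ∑ x₂, jointDist P W ((q.1, x₂), q.2)

/-- A block code of length `n` with `K₁` and `K₂` messages for the MAC with non-causal cribbing:
the `i`-th symbol of Encoder 2 may depend on its own message and on the whole codeword of
Encoder 1. -/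
structure Code (X₁ X₂ : Type*) (K₁ K₂ n : ℕ) where
  /-- the per-symbol maps of Encoder 1 -/
  enc₁ : Fin n → Fin K₁ → X₁
  /-- the per-symbol maps of Encoder 2 -/
  enc₂ : Fin n → Fin K₂ → (Fin n → X₁) → X₂

namespace Code

variable {X₁ X₂ Z : Type*} {K₁ K₂ n : ℕ}

/-- The codeword of Encoder 1. -/
def word₁ (c : Code X₁ X₂ K₁ K₂ n) (m₁ : Fin K₁) : Fin n → X₁ :=
  fun i => c.enc₁ i m₁

/-- The codeword of Encoder 2, which depends on `m₁` only through the codeword of Encoder 1. -/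
def word₂ (c : Code X₁ X₂ K₁ K₂ n) (m₁ : Fin K₁) (m₂ : Fin K₂) : Fin n → X₂ :=
  fun i => c.enc₂ i m₂ (c.word₁ m₁)

/-- The distribution of the channel output `Z^n` when the messages are independent and uniform and
the codewords are sent over `n` independent uses of `W`. -/
def outputDist (c : Code X₁ X₂ K₁ K₂ n) (W : X₁ → X₂ → Z → ℝ) (z : Fin n → Z) : ℝ :=
  (∑ m₁, ∑ m₂, ∏ i, W (c.word₁ m₁ i) (c.word₂ m₁ m₂ i) (z i)) / ((K₁ : ℝ) * (K₂ : ℝ))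

end Code

/-- The number `⌊2^{nR}⌋` of messages at block length `n` and rate `R`. -/
def numMessages (R : ℝ) (n : ℕ) : ℕ := ⌊(2 : ℝ) ^ ((n : ℝ) * R)⌋₊

/-- The nonnegative rate pair `R = (R₁, R₂)` is achievable for the target output `Q`. -/
def Achievable {X₁ X₂ Z : Type*} [Fintype Z] (W : X₁ → X₂ → Z → ℝ) (Q : Z → ℝ)
    (R : ℝ × ℝ) : Prop :=
  0 ≤ R.1 ∧ 0 ≤ R.2 ∧
    ∃ c : ∀ n : ℕ, Code X₁ X₂ (numMessages R.1 n) (numMessages R.2 n) n,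
      Filter.Tendsto (fun n => kl ((c n).outputDist W) (iidDist n Q)) Filter.atTop (nhds 0)

/-- The resolvability region of the MAC `W` with non-causal cribbing for the target output `Q`. -/
def resolvabilityRegion {X₁ X₂ Z : Type*} [Fintype Z] (W : X₁ → X₂ → Z → ℝ) (Q : Z → ℝ) :
    Set (ℝ × ℝ) :=
  closure {R | Achievable W Q R}

end CribbingMAC

end

/-! Achievability is soft covering by a random superposition code. The words of Encoder 1 are drawn
from `p^n`. The words of Encoder 2 are drawn from `V^n` given the first word and are indexed by the
value of that word and `m₂`, since Encoder 2 sees the word and not `m₁`. The expected divergence is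
controlled by a second moment over two message pairs, which interact in three ways: they share only
`m₁`; they share `m₂` and their first words happen to coincide; they are equal. The collision has
probability `p(x₁^n)`, about `2^{-nH(X₁)}`, which is why `R₂` is compared with `I(X₁,X₂;Z) - H(X₁)`.
`exists_codebook` is the one-shot bound. Over `n` uses its logarithm splits into three, one per rate
inequality, and each average decays exponentially by a Chernoff argument
(`tendsto_sum_log_one_add`), so even the unnormalized divergence vanishes.

For the converse, let `P` be the average letter frequency of the pairs of codewords. Label each
message pair by some `k(m)`. A subprobability on labels and outputs cannot predict `Z^n` better, on
average, than the law of `Z^n` itself. If it is a constant times a product over letters, its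
expected logarithm depends on the code only through `P`, so no time-sharing variable is needed
(`sum_letterFreq_logb_le`). The labels `m₁`, `(x₁^n, m₂)` and `(m₁, m₂)` give the three inequalities
up to the divergence. A constant label shows that the output law of `P` is close to `Q`. Compactness
of the simplex and continuity of entropy finish the proof. -/

namespace CribbingMAC

open Finset Filter Topology

/-! ### Moments of independent coordinates. -/

section ProductSums

variable {ι B : Type*} [Fintype ι] [DecidableEq ι] [Fintype B]

lemma sum_prod_apply (f : ι → B → ℝ) : ∑ u : ι → B, ∏ i, f i (u i) = ∏ i, ∑ b, f i b := by
  rw [Finset.prod_univ_sum, Fintype.piFinset_univ]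

lemma sum_prod_mul_apply (p : ι → B → ℝ) (hp : ∀ i, ∑ b, p i b = 1) (j : ι) (g : B → ℝ) :
    ∑ u : ι → B, (∏ i, p i (u i)) * g (u j) = ∑ b, p j b * g b := by
  have h : ∀ u : ι → B, (∏ i, p i (u i)) * g (u j)
      = ∏ i, (p i (u i) * if i = j then g (u i) else 1) := by
    intro u
    rw [Finset.prod_mul_distrib, Finset.prod_ite_eq' univ j]
    simp
  simp_rw [h]
  rw [sum_prod_apply (fun i b => p i b * if i = j then g b else 1), Finset.prod_eq_single j]
  · simp
  · intro i _ hij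
    simp [hij, hp]
  · simp

lemma sum_prod_mul_apply_mul_apply (p : ι → B → ℝ) (hp : ∀ i, ∑ b, p i b = 1) {j k : ι}
    (hjk : j ≠ k) (g h : B → ℝ) :
    ∑ u : ι → B, (∏ i, p i (u i)) * (g (u j) * h (u k))
      = (∑ b, p j b * g b) * ∑ b, p k b * h b := by
  have e : ∀ u : ι → B, (∏ i, p i (u i)) * (g (u j) * h (u k))
      = ∏ i, (p i (u i) * (if i = j then g (u i) else 1) * if i = k then h (u i) else 1) := by
    intro u
    rw [Finset.prod_mul_distrib, Finset.prod_mul_distrib, Finset.prod_ite_eq' univ j,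
      Finset.prod_ite_eq' univ k]
    simp [mul_assoc]
  simp_rw [e]
  rw [sum_prod_apply
    (fun i b => p i b * (if i = j then g b else 1) * if i = k then h b else 1),
    Finset.prod_eq_mul j k hjk]
  · simp [hjk, hjk.symm]
  · intro i _ hi
    simp [hi.1, hi.2, hp]
  · simp
  · simp

/-- Distinct coordinates are independent, so their moment factors; for equal coordinates the product
of means is nonnegative slack. A single bound for both cases allows summation over all pairs of
indices. -/
lemma sum_prod_mul_le (p : ι → B → ℝ) (hp0 : ∀ i b, 0 ≤ p i b) (hp : ∀ i, ∑ b, p i b = 1)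
    (j k : ι) (g h : B → ℝ) (hg : ∀ b, 0 ≤ g b) (hh : ∀ b, 0 ≤ h b) :
    ∑ u : ι → B, (∏ i, p i (u i)) * (g (u j) * h (u k))
      ≤ (∑ b, p j b * g b) * (∑ b, p k b * h b)
        + if j = k then ∑ b, p j b * (g b * h b) else 0 := by
  by_cases hjk : j = k
  · subst hjk
    rw [sum_prod_mul_apply p hp j (fun b => g b * h b), if_pos rfl]
    have h1 := Finset.sum_nonneg fun b (_ : b ∈ univ) => mul_nonneg (hp0 j b) (hg b)
    have h2 := Finset.sum_nonneg fun b (_ : b ∈ univ) => mul_nonneg (hp0 j b) (hh b)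
    nlinarith [mul_nonneg h1 h2]
  · rw [sum_prod_mul_apply_mul_apply p hp hjk, if_neg hjk, add_zero]

lemma sum_prod_eq_one (p : ι → B → ℝ) (hp : ∀ i, ∑ b, p i b = 1) :
    ∑ u : ι → B, ∏ i, p i (u i) = 1 := by
  rw [sum_prod_apply]
  simp [hp]

end ProductSums

/-! ### One-shot soft covering with a superposition codebook. -/

section OneShot

variable {A B : Type*} [Fintype A] [Fintype B] [DecidableEq A]

/-- Second-moment bound for a superposition codebook whose satellite codewords are indexed by the
value of the cloud centre. -/
lemma codebook_pair_le {K₁ K₂ : ℕ} (p : A → ℝ) (V : A → B → ℝ) (hp0 : ∀ a, 0 ≤ p a)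
    (hp : ∑ a, p a = 1) (hV0 : ∀ a b, 0 ≤ V a b) (hV : ∀ a, ∑ b, V a b = 1)
    (g h : A → B → ℝ) (hg : ∀ a b, 0 ≤ g a b) (hh : ∀ a b, 0 ≤ h a b) :
    ∑ u : Fin K₁ → A, (∏ m, p (u m)) * ∑ v : A × Fin K₂ → B, (∏ k, V k.1 (v k)) *
      ((∑ m₁, ∑ m₂, g (u m₁) (v (u m₁, m₂))) * ∑ m₁, ∑ m₂, h (u m₁) (v (u m₁, m₂)))
    ≤ (K₁ * K₂) ^ 2 * ((∑ a, p a * ∑ b, V a b * g a b) * ∑ a, p a * ∑ b, V a b * h a b)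
      + K₁ * K₂ ^ 2 * (∑ a, p a * ((∑ b, V a b * g a b) * ∑ b, V a b * h a b))
      + K₁ ^ 2 * K₂ * (∑ a, p a * (p a * ∑ b, V a b * (g a b * h a b)))
      + K₁ * K₂ * ∑ a, p a * ∑ b, V a b * (g a b * h a b) := by
  set gb : A → ℝ := fun a => ∑ b, V a b * g a b with hgb
  set hb : A → ℝ := fun a => ∑ b, V a b * h a b with hhb
  set kb : A → ℝ := fun a => ∑ b, V a b * (g a b * h a b) with hkb
  have gb0 : ∀ a, 0 ≤ gb a := fun a => sum_nonneg fun b _ => mul_nonneg (hV0 a b) (hg a b)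
  have hb0 : ∀ a, 0 ≤ hb a := fun a => sum_nonneg fun b _ => mul_nonneg (hV0 a b) (hh a b)
  have kb0 : ∀ a, 0 ≤ kb a := fun a =>
    sum_nonneg fun b _ => mul_nonneg (hV0 a b) (mul_nonneg (hg a b) (hh a b))
  -- With the cloud centres fixed, two satellites coincide only when both `m₂` and the values of the
  -- centres agree. The event `u m₁ = u m₁'` is written as a sum over `a` of products of
  -- one-coordinate functions, so that `sum_prod_mul_le` applies again to the average over `u`.
  have inner : ∀ u : Fin K₁ → A, ∑ v : A × Fin K₂ → B, (∏ k, V k.1 (v k)) *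
      ((∑ m₁, ∑ m₂, g (u m₁) (v (u m₁, m₂))) * ∑ m₁, ∑ m₂, h (u m₁) (v (u m₁, m₂)))
      ≤ ∑ m₁, ∑ m₁', ((K₂ : ℝ) ^ 2 * (gb (u m₁) * hb (u m₁'))
        + K₂ * ∑ a, (if u m₁ = a then kb a else 0) * if u m₁' = a then 1 else 0) := by
    intro u
    have e : ∀ v : A × Fin K₂ → B, (∏ k, V k.1 (v k)) *
      ((∑ m₁, ∑ m₂, g (u m₁) (v (u m₁, m₂))) * ∑ m₁, ∑ m₂, h (u m₁) (v (u m₁, m₂)))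
      = ∑ m₁, ∑ m₁', ∑ m₂, ∑ m₂', (∏ k, V k.1 (v k)) *
          (g (u m₁) (v (u m₁, m₂)) * h (u m₁') (v (u m₁', m₂'))) := by
      intro v
      rw [Finset.sum_mul_sum, Finset.mul_sum]
      refine sum_congr rfl fun m₁ _ => ?_
      rw [Finset.mul_sum]
      refine sum_congr rfl fun m₁' _ => ?_
      rw [Finset.sum_mul_sum]
      simp only [Finset.mul_sum]
    simp_rw [e]
    rw [Finset.sum_comm]
    refine sum_le_sum fun m₁ _ => ?_
    rw [Finset.sum_comm]
    refine sum_le_sum fun m₁' _ => ?_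
    rw [Finset.sum_comm]
    calc _ ≤ ∑ m₂ : Fin K₂, ∑ m₂' : Fin K₂, (gb (u m₁) * hb (u m₁')
          + if m₂ = m₂' then (if u m₁ = u m₁' then kb (u m₁) else 0) else 0) := by
          refine sum_le_sum fun m₂ _ => ?_
          rw [Finset.sum_comm]
          refine sum_le_sum fun m₂' _ => ?_
          refine (sum_prod_mul_le (fun k : A × Fin K₂ => V k.1) (fun k => hV0 k.1)
            (fun k => hV k.1) (u m₁, m₂) (u m₁', m₂') (g (u m₁)) (h (u m₁'))
            (hg _) (hh _)).trans ?_
          refine add_le_add le_rfl ?_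
          by_cases h1 : u m₁ = u m₁' <;> by_cases h2 : m₂ = m₂' <;> simp [h1, h2, hkb]
      _ = _ := by
          have : ∑ a, (if u m₁ = a then kb a else 0) * (if u m₁' = a then (1 : ℝ) else 0)
              = if u m₁ = u m₁' then kb (u m₁) else 0 := by
            rw [Finset.sum_eq_single (u m₁)]
            · simp [eq_comm]
            · intro b _ hb'
              simp [hb'.symm]
            · simp
          rw [this]
          simp only [sum_add_distrib, sum_const, card_univ, Fintype.card_fin, nsmul_eq_mul,
            Finset.sum_ite_eq, mem_univ, if_true]
          ring
  calc _ ≤ ∑ u : Fin K₁ → A, (∏ m, p (u m)) *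
        ∑ m₁, ∑ m₁', ((K₂ : ℝ) ^ 2 * (gb (u m₁) * hb (u m₁'))
        + K₂ * ∑ a, (if u m₁ = a then kb a else 0) * if u m₁' = a then 1 else 0) :=
        sum_le_sum fun u _ => mul_le_mul_of_nonneg_left (inner u)
          (prod_nonneg fun m _ => hp0 _)
    _ = ∑ m₁ : Fin K₁, ∑ m₁' : Fin K₁,
        ((K₂ : ℝ) ^ 2 * (∑ u : Fin K₁ → A, (∏ m, p (u m)) * (gb (u m₁) * hb (u m₁')))
        + K₂ * ∑ a, ∑ u : Fin K₁ → A, (∏ m, p (u m)) *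
          ((if u m₁ = a then kb a else 0) * if u m₁' = a then 1 else 0)) := by
        simp_rw [Finset.mul_sum]
        rw [Finset.sum_comm]
        refine sum_congr rfl fun m₁ _ => ?_
        rw [Finset.sum_comm]
        refine sum_congr rfl fun m₁' _ => ?_
        simp_rw [mul_add, Finset.mul_sum, sum_add_distrib]
        congr 1
        · exact sum_congr rfl fun u _ => by ring
        · rw [Finset.sum_comm]
          exact sum_congr rfl fun a _ => sum_congr rfl fun u _ => by ring
    -- A coincidence of centres at `a` costs `p a * p a` for independent draws and `p a` when `m₁ =
    -- m₁'`; these are the last two terms of the bound.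
    _ ≤ ∑ m₁ : Fin K₁, ∑ m₁' : Fin K₁,
        ((K₂ : ℝ) ^ 2 * ((∑ a, p a * gb a) * (∑ a, p a * hb a)
          + if m₁ = m₁' then ∑ a, p a * (gb a * hb a) else 0)
        + K₂ * ∑ a, (p a * (p a * kb a) + if m₁ = m₁' then p a * kb a else 0)) := by
        refine sum_le_sum fun m₁ _ => sum_le_sum fun m₁' _ => ?_
        refine add_le_add (mul_le_mul_of_nonneg_left ?_ (by positivity))
          (mul_le_mul_of_nonneg_left (sum_le_sum fun a _ => ?_) (by positivity))
        · exact sum_prod_mul_le (fun _ : Fin K₁ => p) (fun _ => hp0) (fun _ => hp) m₁ m₁' gb hb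
            gb0 hb0
        · refine (sum_prod_mul_le (fun _ : Fin K₁ => p) (fun _ => hp0) (fun _ => hp) m₁ m₁'
            (fun x => if x = a then kb a else 0) (fun x => if x = a then 1 else 0)
            (fun x => by split_ifs; exacts [kb0 a, le_rfl])
            (fun x => by split_ifs <;> norm_num)).trans (le_of_eq ?_)
          have e1 : ∑ b, p b * (if b = a then kb a else 0) = p a * kb a := by simp
          have e2 : ∑ b, p b * (if b = a then (1 : ℝ) else 0) = p a := by simp
          have e3 : ∑ b, p b * ((if b = a then kb a else 0) * (if b = a then (1 : ℝ) else 0))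
              = p a * kb a := by simp
          simp only [e1, e2, e3]
          ring
    _ = _ := by
        have e : ∀ m₁ m₁' : Fin K₁,
            ∑ a, (p a * (p a * kb a) + if m₁ = m₁' then p a * kb a else 0)
            = ∑ a, p a * (p a * kb a) + if m₁ = m₁' then ∑ a, p a * kb a else 0 := by
          intro m₁ m₁'
          rw [sum_add_distrib]
          split_ifs <;> simp
        simp_rw [e]
        simp only [sum_add_distrib, mul_add, sum_const, card_univ, Fintype.card_fin, nsmul_eq_mul,
          mul_ite, mul_zero, Finset.sum_ite_eq, mem_univ, if_true]
        ring

end OneShot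

/-- The tangent to the logarithm at `t` lies above it. It plays the role of Jensen's inequality,
with a point of tangency that may vary with the codewords. -/
lemma logb_two_le_add {x t : ℝ} (hx : 0 < x) (ht : 0 < t) :
    Real.logb 2 x ≤ Real.logb 2 t + (x / t - 1) / Real.log 2 := by
  have h2 : 0 < Real.log 2 := Real.log_pos one_lt_two
  have h := Real.log_le_sub_one_of_pos (div_pos hx ht)
  rw [Real.log_div hx.ne' ht.ne'] at h
  rw [Real.logb, Real.logb, ← add_div]
  gcongr
  linarith

section OneShot

variable {A B C : Type*} [Fintype A] [Fintype B] [Fintype C] [DecidableEq A]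

lemma codebook_mean {K₁ K₂ : ℕ} (p : A → ℝ) (V : A → B → ℝ)
    (hp : ∑ a, p a = 1) (hV : ∀ a, ∑ b, V a b = 1) (F : A → B → ℝ) :
    ∑ u : Fin K₁ → A, (∏ m, p (u m)) * ∑ v : A × Fin K₂ → B, (∏ k, V k.1 (v k)) *
      (∑ m₁, ∑ m₂, F (u m₁) (v (u m₁, m₂)))
    = K₁ * K₂ * ∑ a, p a * ∑ b, V a b * F a b := by
  have inner : ∀ u : Fin K₁ → A, ∑ v : A × Fin K₂ → B, (∏ k, V k.1 (v k)) *
      (∑ m₁, ∑ m₂, F (u m₁) (v (u m₁, m₂))) = ∑ m₁, K₂ * ∑ b, V (u m₁) b * F (u m₁) b := by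
    intro u
    simp_rw [Finset.mul_sum (s := (univ : Finset (Fin K₁)))]
    rw [Finset.sum_comm]
    refine sum_congr rfl fun m₁ _ => ?_
    simp_rw [Finset.mul_sum (s := (univ : Finset (Fin K₂)))]
    rw [Finset.sum_comm]
    rw [Finset.sum_congr rfl fun m₂ _ => sum_prod_mul_apply (fun k : A × Fin K₂ => V k.1)
      (fun k => hV k.1) (u m₁, m₂) (F (u m₁))]
    simp
  simp_rw [inner, Finset.mul_sum (s := (univ : Finset (Fin K₁)))]
  rw [Finset.sum_comm]
  rw [Finset.sum_congr rfl fun m₁ _ => sum_prod_mul_apply (fun _ : Fin K₁ => p)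
      (fun _ => hp) m₁ (fun a => K₂ * ∑ b, V a b * F a b)]
  simp only [sum_const, card_univ, Fintype.card_fin, nsmul_eq_mul, Finset.mul_sum]
  exact sum_congr rfl fun a _ => sum_congr rfl fun b _ => by ring

/-- The argument of the logarithm in the one-shot soft-covering bound. -/
noncomputable def coverRatio (K₁ K₂ : ℕ) (p : A → ℝ) (V : A → B → ℝ) (W : A → B → C → ℝ) (Q : C → ℝ)
    (a : A) (b : B) (c : C) : ℝ :=
  1 + (∑ b', V a b' * W a b' c) / (K₁ * Q c) + p a * W a b c / (K₂ * Q c)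
    + W a b c / (K₁ * K₂ * Q c)

omit [Fintype A] [Fintype C] [DecidableEq A] in
lemma one_le_coverRatio (K₁ K₂ : ℕ) {p : A → ℝ} {V : A → B → ℝ} {W : A → B → C → ℝ} {Q : C → ℝ}
    (hp0 : ∀ a, 0 ≤ p a) (hV0 : ∀ a b, 0 ≤ V a b) (hW0 : ∀ a b c, 0 ≤ W a b c)
    (hQ0 : ∀ c, 0 ≤ Q c) (a : A) (b : B) (c : C) : 1 ≤ coverRatio K₁ K₂ p V W Q a b c := by
  have h1 : 0 ≤ (∑ b', V a b' * W a b' c) / (K₁ * Q c) :=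
    div_nonneg (sum_nonneg fun b' _ => mul_nonneg (hV0 a b') (hW0 a b' c))
      (mul_nonneg (Nat.cast_nonneg _) (hQ0 c))
  have h2 : 0 ≤ p a * W a b c / (K₂ * Q c) :=
    div_nonneg (mul_nonneg (hp0 a) (hW0 a b c)) (mul_nonneg (Nat.cast_nonneg _) (hQ0 c))
  have h3 : 0 ≤ W a b c / (K₁ * K₂ * Q c) :=
    div_nonneg (hW0 a b c) (mul_nonneg (by positivity) (hQ0 c))
  unfold coverRatio
  linarith

/-- One-shot soft covering for the multiple-access channel with non-causal cribbing. -/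
theorem exists_codebook {K₁ K₂ : ℕ} (hK₁ : 0 < K₁) (hK₂ : 0 < K₂)
    (p : A → ℝ) (V : A → B → ℝ) (W : A → B → C → ℝ) (Q : C → ℝ)
    (hp0 : ∀ a, 0 ≤ p a) (hp : ∑ a, p a = 1) (hV0 : ∀ a b, 0 ≤ V a b)
    (hV : ∀ a, ∑ b, V a b = 1) (hW0 : ∀ a b c, 0 ≤ W a b c) (hW : ∀ a b, ∑ c, W a b c = 1)
    (hQ : ∀ c, Q c = ∑ a, p a * ∑ b, V a b * W a b c) :
    ∃ (u : Fin K₁ → A) (v : A × Fin K₂ → B),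
      (∀ c, Q c = 0 → ∀ m₁ m₂, W (u m₁) (v (u m₁, m₂)) c = 0) ∧
      ∑ c, (∑ m₁, ∑ m₂, W (u m₁) (v (u m₁, m₂)) c) / (K₁ * K₂) *
          Real.logb 2 ((∑ m₁, ∑ m₂, W (u m₁) (v (u m₁, m₂)) c) / (K₁ * K₂) / Q c)
        ≤ ∑ a, p a * ∑ b, V a b * ∑ c, W a b c * Real.logb 2 (coverRatio K₁ K₂ p V W Q a b c) := by
  have k1 : (0 : ℝ) < K₁ := Nat.cast_pos.2 hK₁
  have k2 : (0 : ℝ) < K₂ := Nat.cast_pos.2 hK₂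
  have hl2 : 0 < Real.log 2 := Real.log_pos one_lt_two
  have hQ0 : ∀ c, 0 ≤ Q c := fun c => by
    rw [hQ]
    exact sum_nonneg fun a _ => mul_nonneg (hp0 a)
      (sum_nonneg fun b _ => mul_nonneg (hV0 a b) (hW0 a b c))
  have hT1 := one_le_coverRatio K₁ K₂ hp0 hV0 hW0 hQ0
  set T := coverRatio K₁ K₂ p V W Q with hT
  have hT0 : ∀ a b c, 0 < T a b c := fun a b c => one_pos.trans_le (hT1 a b c)
  set R := ∑ a, p a * ∑ b, V a b * ∑ c, W a b c * Real.logb 2 (T a b c) with hR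
  set Y : (Fin K₁ → A) → (A × Fin K₂ → B) → C → ℝ :=
    fun u v c => ∑ m₁, ∑ m₂, W (u m₁) (v (u m₁, m₂)) c with hY
  -- A codebook of positive probability uses only input pairs of positive probability, and these
  -- give no mass to outputs outside the support of `Q`.
  have hsupp : ∀ (u : Fin K₁ → A) (v : A × Fin K₂ → B),
      (∏ m, p (u m)) ≠ 0 → (∏ k, V k.1 (v k)) ≠ 0 →
      ∀ c, Q c = 0 → ∀ m₁ m₂, W (u m₁) (v (u m₁, m₂)) c = 0 := by
    intro u v hu hv c hc m₁ m₂
    have hu' := Finset.prod_ne_zero_iff.1 hu m₁ (mem_univ _)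
    have hv' := Finset.prod_ne_zero_iff.1 hv (u m₁, m₂) (mem_univ _)
    rw [hQ, sum_eq_zero_iff_of_nonneg (fun a _ => mul_nonneg (hp0 a)
      (sum_nonneg fun b _ => mul_nonneg (hV0 a b) (hW0 a b c)))] at hc
    have h1 := (mul_eq_zero.1 (hc (u m₁) (mem_univ _))).resolve_left hu'
    rw [sum_eq_zero_iff_of_nonneg (fun b _ => mul_nonneg (hV0 _ b) (hW0 _ b c))] at h1
    exact (mul_eq_zero.1 (h1 (v (u m₁, m₂)) (mem_univ _))).resolve_left hv'
  -- The divergence after replacing each logarithm by its tangent at `T`: a first-moment term plus a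
  -- quadratic one, so its mean is within reach of `codebook_mean` and `codebook_pair_le`.
  set Φ : (Fin K₁ → A) → (A × Fin K₂ → B) → ℝ := fun u v =>
    (∑ m₁, ∑ m₂, ∑ c, W (u m₁) (v (u m₁, m₂)) c * Real.logb 2 (T (u m₁) (v (u m₁, m₂)) c))
        / (K₁ * K₂)
      + ((∑ c, ((∑ m₁, ∑ m₂, W (u m₁) (v (u m₁, m₂)) c / T (u m₁) (v (u m₁, m₂)) c) * Y u v c)
        / Q c) / (K₁ * K₂) ^ 2 - 1) / Real.log 2 with hΦ
  have hDΦ : ∀ (u : Fin K₁ → A) (v : A × Fin K₂ → B),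
      (∀ c, Q c = 0 → ∀ m₁ m₂, W (u m₁) (v (u m₁, m₂)) c = 0) →
      ∑ c, Y u v c / (K₁ * K₂) * Real.logb 2 (Y u v c / (K₁ * K₂) / Q c) ≤ Φ u v := by
    intro u v huv
    have hpt : ∀ c m₁ m₂, W (u m₁) (v (u m₁, m₂)) c * Real.logb 2 (Y u v c / (K₁ * K₂) / Q c)
        ≤ W (u m₁) (v (u m₁, m₂)) c * Real.logb 2 (T (u m₁) (v (u m₁, m₂)) c)
          + (W (u m₁) (v (u m₁, m₂)) c / T (u m₁) (v (u m₁, m₂)) c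
              * (Y u v c / Q c / (K₁ * K₂)) - W (u m₁) (v (u m₁, m₂)) c) / Real.log 2 := by
      intro c m₁ m₂
      rcases (hW0 (u m₁) (v (u m₁, m₂)) c).eq_or_lt with h0 | h0
      · simp [← h0]
      · have hQc : 0 < Q c := (hQ0 c).lt_of_ne fun h => h0.ne' (huv c h.symm m₁ m₂)
        have hYc : 0 < Y u v c := h0.trans_le <|
          (single_le_sum (f := fun m₂ => W (u m₁) (v (u m₁, m₂)) c)
            (fun _ _ => hW0 _ _ _) (mem_univ m₂)).trans
          (single_le_sum (f := fun m₁ => ∑ m₂, W (u m₁) (v (u m₁, m₂)) c)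
            (fun _ _ => sum_nonneg fun _ _ => hW0 _ _ _) (mem_univ m₁))
        have := mul_le_mul_of_nonneg_left (logb_two_le_add
          (x := Y u v c / (K₁ * K₂) / Q c) (t := T (u m₁) (v (u m₁, m₂)) c)
          (by positivity) (hT0 _ _ _)) h0.le
        refine this.trans (le_of_eq ?_)
        have := (hT0 (u m₁) (v (u m₁, m₂)) c).ne'
        field_simp
    have hW1 : ∑ c, Y u v c = K₁ * K₂ := by
      simp only [hY]
      rw [Finset.sum_comm]
      rw [Finset.sum_congr rfl fun m₁ _ => Finset.sum_comm]
      simp [hW]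
    calc ∑ c, Y u v c / (K₁ * K₂) * Real.logb 2 (Y u v c / (K₁ * K₂) / Q c)
        = (∑ c, ∑ m₁, ∑ m₂, W (u m₁) (v (u m₁, m₂)) c *
            Real.logb 2 (Y u v c / (K₁ * K₂) / Q c)) / (K₁ * K₂) := by
          rw [Finset.sum_div]
          refine sum_congr rfl fun c _ => ?_
          simp_rw [← Finset.sum_mul]
          rw [div_mul_eq_mul_div]
      _ ≤ (∑ c, ∑ m₁, ∑ m₂, (W (u m₁) (v (u m₁, m₂)) c *
            Real.logb 2 (T (u m₁) (v (u m₁, m₂)) c)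
          + (W (u m₁) (v (u m₁, m₂)) c / T (u m₁) (v (u m₁, m₂)) c
              * (Y u v c / Q c / (K₁ * K₂)) - W (u m₁) (v (u m₁, m₂)) c) / Real.log 2))
            / (K₁ * K₂) := by
          gcongr with c _ m₁ _ m₂ _
          exact hpt c m₁ m₂
      _ = Φ u v := by
          simp only [sum_add_distrib, ← Finset.sum_div, sum_sub_distrib, ← Finset.sum_mul]
          rw [hW1]
          have e1 : ∑ c, ∑ m₁, ∑ m₂, W (u m₁) (v (u m₁, m₂)) c *
            Real.logb 2 (T (u m₁) (v (u m₁, m₂)) c) = ∑ m₁, ∑ m₂, ∑ c, W (u m₁) (v (u m₁, m₂)) c *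
            Real.logb 2 (T (u m₁) (v (u m₁, m₂)) c) := by
            rw [Finset.sum_comm]
            exact Finset.sum_congr rfl fun m₁ _ => Finset.sum_comm
          have e2 : ∑ c, (∑ m₁, ∑ m₂, W (u m₁) (v (u m₁, m₂)) c / T (u m₁) (v (u m₁, m₂)) c)
              * (Y u v c / Q c / (K₁ * K₂))
              = (∑ c, ((∑ m₁, ∑ m₂, W (u m₁) (v (u m₁, m₂)) c / T (u m₁) (v (u m₁, m₂)) c)
                * Y u v c) / Q c) / (K₁ * K₂) := by
            rw [Finset.sum_div]
            exact sum_congr rfl fun c _ => by ring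
          rw [e1, e2]
          simp only [hΦ]
          field_simp
  have hpair : ∀ c, ∑ u : Fin K₁ → A, (∏ m, p (u m)) * ∑ v : A × Fin K₂ → B,
      (∏ k, V k.1 (v k)) * (((∑ m₁, ∑ m₂, W (u m₁) (v (u m₁, m₂)) c
        / T (u m₁) (v (u m₁, m₂)) c) * Y u v c) / Q c) ≤ (K₁ * K₂) ^ 2 * Q c := by
    intro c
    rcases (hQ0 c).eq_or_lt with h0 | h0
    · simp [← h0]
    have := codebook_pair_le (K₁ := K₁) (K₂ := K₂) p V hp0 hp hV0 hV
      (fun a b => W a b c / T a b c) (fun a b => W a b c)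
      (fun a b => div_nonneg (hW0 _ _ _) (hT0 _ _ _).le) (fun a b => hW0 _ _ _)
    simp only [← mul_div_assoc, ← Finset.sum_div]
    rw [div_le_iff₀ h0]
    refine this.trans (le_of_eq ?_)
    -- `coverRatio` is chosen for this identity: the four second-moment terms, each carrying `W /
    -- T`, add up to a multiple of `T`, so `T` cancels and the tangent correction is at most zero on
    -- average.
    have hrow : ∀ a, (K₁ * K₂ : ℝ) ^ 2 * ((∑ b, V a b * W a b c / T a b c) * Q c)
        + K₁ * K₂ ^ 2 * ((∑ b, V a b * W a b c / T a b c) * ∑ b, V a b * W a b c)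
        + K₁ ^ 2 * K₂ * (p a * ∑ b, V a b * (W a b c * W a b c) / T a b c)
        + K₁ * K₂ * (∑ b, V a b * (W a b c * W a b c) / T a b c)
        = (K₁ * K₂) ^ 2 * Q c * ∑ b, V a b * W a b c := by
      intro a
      set hb := ∑ b, V a b * W a b c with hhb
      simp only [Finset.sum_mul, Finset.mul_sum, ← Finset.sum_add_distrib]
      rw [hhb, Finset.mul_sum]
      refine sum_congr rfl fun b _ => ?_
      have e : T a b c = 1 + hb / (K₁ * Q c) + p a * W a b c / (K₂ * Q c)
        + W a b c / (K₁ * K₂ * Q c) := rfl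
      have h := (hT0 a b c).ne'
      have e' : T a b c * (K₁ * K₂ * Q c) = K₁ * K₂ * Q c + K₂ * hb + K₁ * (p a * W a b c)
          + W a b c := by
        rw [e]; field_simp
      rw [← hhb]
      have h3 : V a b * (W a b c * W a b c) / T a b c = V a b * W a b c / T a b c * W a b c := by
        ring
      rw [h3]
      have h4 : V a b * W a b c = V a b * W a b c / T a b c * T a b c := by
        field_simp
      conv_rhs => rw [h4]
      linear_combination (-(K₁ * K₂ * (V a b * W a b c / T a b c)) : ℝ) * e'
    have hQc := hQ c
    calc _ = ∑ a, p a * ((K₁ * K₂ : ℝ) ^ 2 * ((∑ b, V a b * W a b c / T a b c) * Q c)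
        + K₁ * K₂ ^ 2 * ((∑ b, V a b * W a b c / T a b c) * ∑ b, V a b * W a b c)
        + K₁ ^ 2 * K₂ * (p a * ∑ b, V a b * (W a b c * W a b c) / T a b c)
        + K₁ * K₂ * (∑ b, V a b * (W a b c * W a b c) / T a b c)) := by
          rw [← hQc]
          have e3 : ∀ a b, V a b * (W a b c / T a b c * W a b c)
            = V a b * (W a b c * W a b c) / T a b c := fun a b => by ring
          have e4 : ∀ a b, V a b * (W a b c / T a b c) = V a b * W a b c / T a b c :=
            fun a b => by ring
          simp_rw [e3, e4]
          rw [Finset.sum_mul]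
          simp only [Finset.mul_sum (s := (univ : Finset A)), ← Finset.sum_add_distrib]
          exact sum_congr rfl fun a _ => by ring
      _ = _ := by
          simp_rw [hrow]
          rw [hQc]
          simp_rw [← hQc]
          rw [Finset.sum_congr rfl fun a _ => show p a * ((K₁ * K₂ : ℝ) ^ 2 * Q c *
            ∑ b, V a b * W a b c) = (K₁ * K₂ : ℝ) ^ 2 * Q c * (p a * ∑ b, V a b * W a b c) by ring,
            ← Finset.mul_sum, ← hQc]
  have hω1 : ∑ u : Fin K₁ → A, (∏ m, p (u m)) * ∑ v : A × Fin K₂ → B, (∏ k, V k.1 (v k)) = 1 := by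
    rw [sum_prod_eq_one (fun k : A × Fin K₂ => V k.1) (fun k => hV k.1)]
    simp [sum_prod_eq_one (fun _ : Fin K₁ => p) (fun _ => hp)]
  have hQ1 : ∑ c, Q c = 1 := by
    simp_rw [hQ]
    rw [Finset.sum_comm]
    simp_rw [← Finset.mul_sum]
    rw [Finset.sum_congr rfl fun a _ => congrArg (p a * ·) Finset.sum_comm]
    simp_rw [← Finset.mul_sum, hW, mul_one, hV, mul_one, hp]
  have hEΦ : ∑ u : Fin K₁ → A, (∏ m, p (u m)) * ∑ v : A × Fin K₂ → B,
      (∏ k, V k.1 (v k)) * Φ u v ≤ R := by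
    have hm := codebook_mean (K₁ := K₁) (K₂ := K₂) p V hp hV
      (fun a b => ∑ c, W a b c * Real.logb 2 (T a b c))
    have hs := Finset.sum_le_sum fun c (_ : c ∈ univ) => hpair c
    rw [← Finset.mul_sum, hQ1, mul_one, Finset.sum_comm] at hs
    rw [Finset.sum_congr rfl fun u _ => (Finset.mul_sum _ _ _).symm] at hs
    rw [Finset.sum_congr rfl fun u _ => congrArg ((∏ m, p (u m)) * ·) Finset.sum_comm] at hs
    simp_rw [← Finset.mul_sum] at hs
    calc _ = (∑ u : Fin K₁ → A, (∏ m, p (u m)) * ∑ v : A × Fin K₂ → B, (∏ k, V k.1 (v k)) *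
        (∑ m₁, ∑ m₂, ∑ c, W (u m₁) (v (u m₁, m₂)) c *
          Real.logb 2 (T (u m₁) (v (u m₁, m₂)) c))) / (K₁ * K₂)
        + ((∑ u : Fin K₁ → A, (∏ m, p (u m)) * ∑ v : A × Fin K₂ → B, (∏ k, V k.1 (v k)) *
          ∑ c, ((∑ m₁, ∑ m₂, W (u m₁) (v (u m₁, m₂)) c / T (u m₁) (v (u m₁, m₂)) c) * Y u v c)
        / Q c) / (K₁ * K₂) ^ 2 - ∑ u : Fin K₁ → A, (∏ m, p (u m)) *
          ∑ v : A × Fin K₂ → B, (∏ k, V k.1 (v k))) / Real.log 2 := by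
          simp only [hΦ, mul_add, Finset.sum_add_distrib, mul_sub, Finset.sum_sub_distrib,
            mul_one, sub_div, ← mul_div_assoc, ← Finset.sum_div]
      _ ≤ R + ((K₁ * K₂) ^ 2 / (K₁ * K₂) ^ 2 - 1) / Real.log 2 := by
          rw [hω1, hm]
          gcongr
          rw [mul_div_cancel_left₀ _ (by positivity)]
      _ = R := by
          rw [div_self (by positivity)]
          simp
  -- If every codebook supported where `Q` is exceeded `R`, then `Φ` would exceed `R` on all
  -- codebooks of positive weight, against `hEΦ`. Strictness of the average needs one such codebook,
  -- which exists because the weights sum to one.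
  by_contra hcon
  push Not at hcon
  have hle : ∀ (u : Fin K₁ → A) (v : A × Fin K₂ → B),
      (∏ m, p (u m)) * ((∏ k, V k.1 (v k)) * R) ≤ (∏ m, p (u m)) * ((∏ k, V k.1 (v k)) * Φ u v) ∧
      ((∏ m, p (u m)) * (∏ k, V k.1 (v k)) ≠ 0 →
      (∏ m, p (u m)) * ((∏ k, V k.1 (v k)) * R)
        < (∏ m, p (u m)) * ((∏ k, V k.1 (v k)) * Φ u v)) := by
    intro u v
    have hu : 0 ≤ ∏ m, p (u m) := prod_nonneg fun _ _ => hp0 _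
    have hv : 0 ≤ ∏ k, V k.1 (v k) := prod_nonneg fun _ _ => hV0 _ _
    have key : (∏ m, p (u m)) * (∏ k, V k.1 (v k)) ≠ 0 →
      (∏ m, p (u m)) * ((∏ k, V k.1 (v k)) * R)
        < (∏ m, p (u m)) * ((∏ k, V k.1 (v k)) * Φ u v) := by
      intro h
      have hu' := left_ne_zero_of_mul h
      have hv' := right_ne_zero_of_mul h
      have hs := hsupp u v hu' hv'
      have := (hcon u v hs).trans_le (hDΦ u v hs)
      have := hu.lt_of_ne' hu'
      have := hv.lt_of_ne' hv'
      gcongr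
    refine ⟨?_, key⟩
    by_cases h : (∏ m, p (u m)) * (∏ k, V k.1 (v k)) = 0
    · rw [← mul_assoc, ← mul_assoc, h]
      simp
    · exact (key h).le
  have hne : ∃ (u : Fin K₁ → A) (v : A × Fin K₂ → B), (∏ m, p (u m)) * (∏ k : A × Fin K₂, V k.1 (v k)) ≠ 0 := by
    by_contra hall
    push Not at hall
    rw [Finset.sum_eq_zero fun u _ => by
      rw [Finset.mul_sum]; exact sum_eq_zero fun v _ => hall u v] at hω1
    exact zero_ne_one hω1
  obtain ⟨u₀, v₀, h₀⟩ := hne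
  have hlt : ∑ u : Fin K₁ → A, (∏ m, p (u m)) * ∑ v : A × Fin K₂ → B, (∏ k, V k.1 (v k)) * R
      < ∑ u : Fin K₁ → A, (∏ m, p (u m)) * ∑ v : A × Fin K₂ → B, (∏ k, V k.1 (v k)) * Φ u v := by
    simp_rw [Finset.mul_sum]
    refine sum_lt_sum (fun u _ => sum_le_sum fun v _ => (hle u v).1) ⟨u₀, mem_univ _, ?_⟩
    exact sum_lt_sum (fun v _ => (hle u₀ v).1) ⟨v₀, mem_univ _, (hle u₀ v₀).2 h₀⟩
  have : ∑ u : Fin K₁ → A, (∏ m, p (u m)) * ∑ v : A × Fin K₂ → B, (∏ k, V k.1 (v k)) * R = R := by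
    calc _ = (∑ u : Fin K₁ → A, (∏ m, p (u m)) * ∑ v : A × Fin K₂ → B, ∏ k, V k.1 (v k)) * R := by
          rw [Finset.sum_mul]
          exact sum_congr rfl fun u _ => by rw [← Finset.sum_mul, mul_assoc]
      _ = R := by rw [hω1, one_mul]
  linarith

end OneShot

/-! ### Exponential decay of the covering terms. -/

/-- Subadditivity of `x ↦ x ^ s` gives `s log (1 + x) ≤ log (1 + x ^ s) ≤ x ^ s`. The power, unlike
the logarithm, factors over the letters of a block. -/
lemma log_one_add_le_rpow_div {x s : ℝ} (hx : 0 ≤ x) (hs : 0 < s) (hs1 : s ≤ 1) :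
    Real.log (1 + x) ≤ x ^ s / s := by
  rw [le_div_iff₀ hs, mul_comm, ← Real.log_rpow (by linarith)]
  have h := Real.rpow_add_le_add_rpow zero_le_one hx hs.le hs1
  rw [Real.one_rpow] at h
  have h0 : 0 ≤ x ^ s := Real.rpow_nonneg hx s
  refine (Real.log_le_log (Real.rpow_pos_of_pos (by linarith) s) h).trans ?_
  have := Real.log_le_sub_one_of_pos (show 0 < 1 + x ^ s by linarith)
  linarith

/-- At `s = 0` the sum is one and its derivative is the negative mean of `log g`, so it drops below
one for small `s > 0`. -/
lemma exists_sum_mul_rpow_lt_one {S : Type*} [Fintype S] (w g : S → ℝ) (hw1 : ∑ x, w x = 1)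
    (hg : ∀ x, w x ≠ 0 → 0 < g x) (hneg : ∑ x, w x * Real.log (g x) < 0) :
    ∃ s : ℝ, 0 < s ∧ s ≤ 1 ∧ ∑ x, w x * g x ^ s < 1 := by
  have hd : HasDerivAt (fun s : ℝ => ∑ x, w x * g x ^ s) (∑ x, w x * Real.log (g x)) 0 := by
    have : ∀ x ∈ univ, HasDerivAt (fun s : ℝ => w x * g x ^ s) (w x * Real.log (g x)) 0 := by
      intro x _
      by_cases h : w x = 0
      · simpa [h] using hasDerivAt_const (0 : ℝ) (0 : ℝ)
      · simpa using ((Real.hasStrictDerivAt_const_rpow (hg x h) 0).hasDerivAt).const_mul (w x)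
    exact HasDerivAt.fun_sum this
  have hslope := (hasDerivAt_iff_tendsto_slope.1 hd).mono_left
    (nhdsWithin_mono 0 (fun s (hs : s ∈ Set.Ioi (0 : ℝ)) => (Set.mem_Ioi.1 hs).ne'))
  have h1 := hslope.eventually (gt_mem_nhds hneg)
  have h2 : ∀ᶠ s : ℝ in 𝓝[>] 0, s ∈ Set.Ioc (0 : ℝ) 1 := Ioc_mem_nhdsGT one_pos
  obtain ⟨s, hs, hs0, hs1⟩ := (h1.and h2).exists
  refine ⟨s, hs0, hs1, ?_⟩
  rw [slope_def_field] at hs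
  simp only [Real.rpow_zero, mul_one, hw1, sub_zero] at hs
  have := (div_lt_iff₀ hs0).1 hs
  linarith

section Triple

variable {X₁ X₂ Z : Type*} [Fintype X₁] [Fintype X₂] [Fintype Z]

lemma triple_sum_prod (n : ℕ) (G : X₁ → X₂ → Z → ℝ) :
    ∑ a : Fin n → X₁, ∑ b : Fin n → X₂, ∑ c : Fin n → Z, ∏ i, G (a i) (b i) (c i)
      = (∑ x, ∑ y, ∑ z, G x y z) ^ n := by
  simp_rw [fun (a : Fin n → X₁) (b : Fin n → X₂) => sum_prod_apply (fun i z => G (a i) (b i) z),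
    fun (a : Fin n → X₁) => sum_prod_apply (fun i y => ∑ z, G (a i) y z),
    sum_prod_apply (fun (_ : Fin n) x => ∑ y, ∑ z, G x y z)]
  simp

/-- Dividing `f` by `2 ^ R` makes its mean logarithm negative, so some power has mean `r < 1` and
the sum is at most `4 ^ s / s * r ^ n`. The factor `1 / 4` in `hK` leaves room for rounding down two
message counts. -/
lemma tendsto_sum_log_one_add (w f : X₁ → X₂ → Z → ℝ) (hw0 : ∀ x y z, 0 ≤ w x y z)
    (hw1 : ∑ x, ∑ y, ∑ z, w x y z = 1) (hf0 : ∀ x y z, 0 ≤ f x y z)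
    (hf : ∀ x y z, w x y z ≠ 0 → 0 < f x y z) {R : ℝ}
    (hR : ∑ x, ∑ y, ∑ z, w x y z * Real.logb 2 (f x y z) < R) (K : ℕ → ℝ)
    (hK : ∀ n : ℕ, (2 : ℝ) ^ (n * R) / 4 ≤ K n) :
    Tendsto (fun n => ∑ a : Fin n → X₁, ∑ b : Fin n → X₂, ∑ c : Fin n → Z,
      (∏ i, w (a i) (b i) (c i)) * Real.log (1 + (∏ i, f (a i) (b i) (c i)) / K n))
      atTop (𝓝 0) := by
  have hl2 : 0 < Real.log 2 := Real.log_pos one_lt_two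
  set g : X₁ → X₂ → Z → ℝ := fun x y z => f x y z / 2 ^ R with hg
  have h2R : (0 : ℝ) < 2 ^ R := Real.rpow_pos_of_pos two_pos R
  have hg0 : ∀ x y z, 0 ≤ g x y z := fun x y z => div_nonneg (hf0 x y z) h2R.le
  obtain ⟨s, hs0, hs1, hs⟩ := exists_sum_mul_rpow_lt_one
    (fun q : X₁ × X₂ × Z => w q.1 q.2.1 q.2.2) (fun q => g q.1 q.2.1 q.2.2)
    (by simpa only [Fintype.sum_prod_type] using hw1)
    (fun q hq => div_pos (hf _ _ _ hq) h2R) (by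
      simp only [Fintype.sum_prod_type]
      have : ∀ x y z, w x y z * Real.log (g x y z)
          = Real.log 2 * (w x y z * Real.logb 2 (f x y z)) - Real.log 2 * R * w x y z := by
        intro x y z
        by_cases h : w x y z = 0
        · simp [h]
        · rw [hg]
          simp only
          rw [Real.log_div (hf x y z h).ne' h2R.ne', Real.log_rpow two_pos, Real.logb]
          field_simp
      simp_rw [this, Finset.sum_sub_distrib, ← Finset.mul_sum, hw1]
      nlinarith)
  simp only [Fintype.sum_prod_type] at hs
  set r := ∑ x, ∑ y, ∑ z, w x y z * g x y z ^ s with hr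
  have hr0 : 0 ≤ r := sum_nonneg fun x _ => sum_nonneg fun y _ => sum_nonneg fun z _ =>
    mul_nonneg (hw0 x y z) (Real.rpow_nonneg (hg0 x y z) s)
  have hK0 : ∀ n, 0 < K n := fun n =>
    (div_pos (Real.rpow_pos_of_pos two_pos _) four_pos).trans_le (hK n)
  have hup : Tendsto (fun n : ℕ => 4 ^ s / s * r ^ n) atTop (𝓝 0) := by
    simpa using (tendsto_pow_atTop_nhds_zero_of_lt_one hr0 hs).const_mul (4 ^ s / s)
  refine squeeze_zero (fun n => ?_) (fun n => ?_) hup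
  · refine sum_nonneg fun a _ => sum_nonneg fun b _ => sum_nonneg fun c _ =>
      mul_nonneg (prod_nonneg fun i _ => hw0 _ _ _) (Real.log_nonneg ?_)
    have : 0 ≤ (∏ i, f (a i) (b i) (c i)) / K n :=
      div_nonneg (prod_nonneg fun i _ => hf0 _ _ _) (hK0 n).le
    linarith
  · rw [hr, ← triple_sum_prod n (fun x y z => w x y z * g x y z ^ s)]
    simp_rw [Finset.mul_sum]
    refine sum_le_sum fun a _ => sum_le_sum fun b _ => sum_le_sum fun c _ => ?_
    rw [Finset.prod_mul_distrib, Real.finsetProd_rpow _ _ (fun i _ => hg0 _ _ _)]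
    have hF0 : 0 ≤ ∏ i, f (a i) (b i) (c i) := prod_nonneg fun i _ => hf0 _ _ _
    have hle : (∏ i, f (a i) (b i) (c i)) / K n ≤ 4 * ∏ i, g (a i) (b i) (c i) := by
      have : ∏ i, g (a i) (b i) (c i) = (∏ i, f (a i) (b i) (c i)) / 2 ^ (n * R) := by
        simp only [hg]
        rw [Finset.prod_div_distrib, prod_const, card_univ, Fintype.card_fin, mul_comm (n : ℝ),
          Real.rpow_mul_natCast two_pos.le]
      rw [this, ← mul_div_assoc, div_le_div_iff₀ (hK0 n) (Real.rpow_pos_of_pos two_pos _)]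
      have := hK n
      nlinarith
    have h1 := log_one_add_le_rpow_div (div_nonneg hF0 (hK0 n).le) hs0 hs1
    have h2 := Real.rpow_le_rpow (div_nonneg hF0 (hK0 n).le) hle hs0.le
    rw [Real.mul_rpow (by norm_num) (prod_nonneg fun i _ => hg0 _ _ _)] at h2
    calc _ ≤ (∏ i, w (a i) (b i) (c i)) * (4 ^ s * (∏ i, g (a i) (b i) (c i)) ^ s / s) := by
          refine mul_le_mul_of_nonneg_left (h1.trans ?_) (prod_nonneg fun i _ => hw0 _ _ _)
          gcongr
      _ = _ := by ring

end Triple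

/-! ### Gibbs' inequality and forms of mutual information. -/

section Gibbs

variable {A B : Type*} [Fintype A] [Fintype B]

/-- The squared Hellinger distance is dominated by the Kullback-Leibler divergence. -/
lemma sum_sqrt_sub_sq_le (P Q : A → ℝ) (hP : P ∈ stdSimplex ℝ A) (hQ : Q ∈ stdSimplex ℝ A)
    (hPQ : ∀ x, Q x = 0 → P x = 0) :
    ∑ x, (√(P x) - √(Q x)) ^ 2 ≤ Real.log 2 * ∑ x, P x * Real.logb 2 (P x / Q x) := by
  have hl2 : 0 < Real.log 2 := Real.log_pos one_lt_two
  -- Apply `log y ≤ y - 1` at `y = √(Q / P)`, which gives `P log (P / Q) ≥ 2 P - 2 √(P Q)`; the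
  -- surplus `Q - P` sums to zero.
  have hpt : ∀ x, (√(P x) - √(Q x)) ^ 2 ≤ Real.log 2 * (P x * Real.logb 2 (P x / Q x))
      + (Q x - P x) := by
    intro x
    rcases (hP.1 x).eq_or_lt with h | h
    · simp [← h, Real.sq_sqrt (hQ.1 x)]
    · have hq : 0 < Q x := (hQ.1 x).lt_of_ne' fun h' => h.ne' (hPQ x h')
      have hp' := Real.sqrt_pos.2 h
      have hq' := Real.sqrt_pos.2 hq
      have h1 := Real.log_le_sub_one_of_pos (div_pos hq' hp')
      have h2 : Real.log 2 * (P x * Real.logb 2 (P x / Q x))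
          = - (2 * P x * Real.log (√(Q x) / √(P x))) := by
        rw [Real.logb, Real.log_div h.ne' hq.ne', Real.log_div hq'.ne' hp'.ne',
          Real.log_sqrt h.le, Real.log_sqrt hq.le]
        field_simp
        ring
      have h3 : P x * (√(Q x) / √(P x)) = √(P x) * √(Q x) := by
        nth_rewrite 1 [← Real.mul_self_sqrt h.le]
        field_simp
      rw [h2]
      have h4 := mul_le_mul_of_nonneg_left h1 h.le
      have h5 := Real.mul_self_sqrt h.le
      have h6 := Real.mul_self_sqrt hq.le
      nlinarith
  refine (sum_le_sum fun x _ => hpt x).trans (le_of_eq ?_)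
  rw [sum_add_distrib, sum_sub_distrib, hP.2, hQ.2, Finset.mul_sum]
  ring

lemma sum_mul_logb_div_nonneg (P Q : A → ℝ) (hP : P ∈ stdSimplex ℝ A) (hQ : Q ∈ stdSimplex ℝ A)
    (hPQ : ∀ x, Q x = 0 → P x = 0) : 0 ≤ ∑ x, P x * Real.logb 2 (P x / Q x) := by
  have h := sum_sqrt_sub_sq_le P Q hP hQ hPQ
  have h0 : 0 ≤ ∑ x, (√(P x) - √(Q x)) ^ 2 := sum_nonneg fun x _ => sq_nonneg _
  exact nonneg_of_mul_nonneg_right (h0.trans h) (Real.log_pos one_lt_two)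

lemma mutualInfo_eq (P : A → ℝ) (R : A → B → ℝ) (hR : ∀ a, ∑ b, R a b = 1) :
    mutualInfo (fun q : A × B => P q.1 * R q.1 q.2)
      = ∑ a, ∑ b, P a * R a b * Real.logb 2 (R a b / ∑ a', P a' * R a' b) := by
  unfold mutualInfo
  refine sum_congr rfl fun a _ => sum_congr rfl fun b _ => ?_
  have h1 : fstMarginal (fun q : A × B => P q.1 * R q.1 q.2) a = P a := by
    simp [fstMarginal, ← Finset.mul_sum, hR]
  rw [h1]
  by_cases h : P a = 0
  · simp [h]
  · simp only [sndMarginal]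
    rw [mul_div_mul_left _ _ h]

end Gibbs

/-! ### Conditional laws and mutual information as sums over triples. -/

section Marginals

variable {X₁ X₂ Z : Type*} [Fintype X₁] [Fintype X₂] [Fintype Z]

lemma exists_conditional (P : X₁ × X₂ → ℝ) (hP : P ∈ stdSimplex ℝ (X₁ × X₂)) :
    ∃ V : X₁ → X₂ → ℝ, (∀ x y, 0 ≤ V x y) ∧ (∀ x, ∑ y, V x y = 1) ∧
      ∀ x y, fstMarginal P x * V x y = P (x, y) := by
  classical
  have h0 : ∀ x, 0 ≤ fstMarginal P x := fun x => sum_nonneg fun y _ => hP.1 _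
  -- On a letter of mass zero any distribution would do; the second marginal is one that is already
  -- at hand.
  refine ⟨fun x y => if fstMarginal P x = 0 then sndMarginal P y else P (x, y) / fstMarginal P x,
    fun x y => ?_, fun x => ?_, fun x y => ?_⟩
  · dsimp only
    split_ifs
    · exact sum_nonneg fun x _ => hP.1 _
    · exact div_nonneg (hP.1 _) (h0 x)
  · by_cases h : fstMarginal P x = 0
    · simp only [h, if_true]
      rw [← hP.2, Fintype.sum_prod_type, Finset.sum_comm]
      rfl
    · simp only [h, if_false]
      rw [← Finset.sum_div]
      exact div_self h
  · by_cases h : fstMarginal P x = 0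
    · simp only [h, if_true, zero_mul]
      exact ((sum_eq_zero_iff_of_nonneg fun y _ => hP.1 _).1 h y (mem_univ _)).symm
    · simp only [h, if_false]
      field_simp

lemma fstMarginal_mem (P : X₁ × X₂ → ℝ) (hP : P ∈ stdSimplex ℝ (X₁ × X₂)) :
    fstMarginal P ∈ stdSimplex ℝ X₁ :=
  ⟨fun x => sum_nonneg fun y _ => hP.1 _, by
    rw [← hP.2, Fintype.sum_prod_type]
    rfl⟩

lemma mutualInfo_jointDist (P : X₁ × X₂ → ℝ) (W : X₁ → X₂ → Z → ℝ) (hW : IsChannel W) :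
    mutualInfo (jointDist P W) = ∑ x, ∑ y, ∑ z, P (x, y) * W x y z *
      Real.logb 2 (W x y z / sndMarginal (jointDist P W) z) := by
  have := mutualInfo_eq P (fun q : X₁ × X₂ => W q.1 q.2) (fun q => (hW q.1 q.2).2)
  rw [Fintype.sum_prod_type] at this
  exact this

/-- Written with the weights of the full triple, so that all rate conditions are expectations under
one law. -/
lemma mutualInfo_jointDistFst (P : X₁ × X₂ → ℝ) (W : X₁ → X₂ → Z → ℝ) (hW : IsChannel W)
    (V : X₁ → X₂ → ℝ) (hV : ∀ x, ∑ y, V x y = 1)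
    (hPV : ∀ x y, fstMarginal P x * V x y = P (x, y)) :
    mutualInfo (jointDistFst P W) = ∑ x, ∑ y, ∑ z, P (x, y) * W x y z *
      Real.logb 2 ((∑ y', V x y' * W x y' z) / sndMarginal (jointDist P W) z) := by
  have e : jointDistFst P W
      = fun q : X₁ × Z => fstMarginal P q.1 * ∑ y', V q.1 y' * W q.1 y' q.2 := by
    funext q
    simp only [jointDistFst, jointDist, Finset.mul_sum, ← mul_assoc, hPV]
  rw [e, mutualInfo_eq (fstMarginal P) (fun x z => ∑ y', V x y' * W x y' z) (fun x => by
    rw [Finset.sum_comm]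
    simp_rw [← Finset.mul_sum, (hW x _).2, mul_one, hV])]
  have e2 : ∀ z, ∑ x, fstMarginal P x * ∑ y', V x y' * W x y' z
      = sndMarginal (jointDist P W) z := by
    intro z
    simp only [Finset.mul_sum, ← mul_assoc, hPV, sndMarginal, jointDist, Fintype.sum_prod_type]
  refine sum_congr rfl fun x _ => ?_
  rw [Finset.sum_comm]
  refine sum_congr rfl fun z _ => ?_
  rw [e2, ← Finset.sum_mul, Finset.mul_sum]
  simp only [← mul_assoc, hPV]

end Marginals

/-! ### Message counts, product laws and output distributions. -/

lemma numMessages_le (R : ℝ) (n : ℕ) : (numMessages R n : ℝ) ≤ 2 ^ (n * R) :=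
  Nat.floor_le (Real.rpow_nonneg two_pos.le _)

lemma one_le_two_rpow {R : ℝ} (hR : 0 ≤ R) (n : ℕ) : (1 : ℝ) ≤ 2 ^ (n * R) :=
  Real.one_le_rpow one_le_two (by positivity)

lemma numMessages_pos {R : ℝ} (hR : 0 ≤ R) (n : ℕ) : 0 < numMessages R n :=
  Nat.floor_pos.2 (one_le_two_rpow hR n)

lemma half_le_numMessages {R : ℝ} (hR : 0 ≤ R) (n : ℕ) :
    (2 : ℝ) ^ (n * R) / 2 ≤ numMessages R n := by
  have h1 : (2 : ℝ) ^ (n * R) < numMessages R n + 1 := Nat.lt_floor_add_one _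
  have h2 : (1 : ℝ) ≤ numMessages R n := by exact_mod_cast numMessages_pos hR n
  linarith

section

variable {X₁ X₂ Z : Type*} [Fintype Z]

lemma kl_eq_of_absCont {P Q : Z → ℝ} (h : ∀ x, Q x = 0 → P x = 0) :
    kl P Q = ((∑ x, P x * Real.logb 2 (P x / Q x) : ℝ) : EReal) := by
  unfold kl
  rw [if_pos h]

lemma iidDist_mem (n : ℕ) (Q : Z → ℝ) (hQ : Q ∈ stdSimplex ℝ Z) :
    iidDist n Q ∈ stdSimplex ℝ (Fin n → Z) :=
  ⟨fun _ => prod_nonneg fun _ _ => hQ.1 _, sum_prod_eq_one (fun _ : Fin n => Q) fun _ => hQ.2⟩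

lemma sum_channel_prod (W : X₁ → X₂ → Z → ℝ) (hW : IsChannel W) {n : ℕ} (a : Fin n → X₁)
    (b : Fin n → X₂) : ∑ c : Fin n → Z, ∏ i, W (a i) (b i) (c i) = 1 :=
  sum_prod_eq_one (fun i => W (a i) (b i)) fun _ => (hW _ _).2

lemma outputDist_mem {K₁ K₂ n : ℕ} (hK₁ : 0 < K₁) (hK₂ : 0 < K₂) (W : X₁ → X₂ → Z → ℝ)
    (hW : IsChannel W) (c : Code X₁ X₂ K₁ K₂ n) :
    c.outputDist W ∈ stdSimplex ℝ (Fin n → Z) := by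
  have k1 : (0 : ℝ) < K₁ := Nat.cast_pos.2 hK₁
  have k2 : (0 : ℝ) < K₂ := Nat.cast_pos.2 hK₂
  refine ⟨fun z => div_nonneg (sum_nonneg fun _ _ => sum_nonneg fun _ _ =>
    prod_nonneg fun _ _ => (hW _ _).1 _) (by positivity), ?_⟩
  simp only [Code.outputDist]
  rw [← Finset.sum_div, Finset.sum_comm, Finset.sum_congr rfl fun m₁ _ => Finset.sum_comm]
  simp_rw [sum_channel_prod W hW]
  simp [k1.ne', k2.ne']

end

/-! ### Achievability by random coding. -/

section Achievability

variable {X₁ X₂ Z : Type*} [Fintype X₁] [Fintype X₂] [Fintype Z]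

/-- Random coding over `n` uses of the channel. -/
lemma exists_code {n K₁ K₂ : ℕ} (hK₁ : 0 < K₁) (hK₂ : 0 < K₂) (W : X₁ → X₂ → Z → ℝ)
    (hW : IsChannel W) (Q : Z → ℝ) (hQ : Q ∈ stdSimplex ℝ Z)
    (p : X₁ → ℝ) (V : X₁ → X₂ → ℝ) (hp0 : ∀ x, 0 ≤ p x)
    (hp : ∑ x, p x = 1) (hV0 : ∀ x y, 0 ≤ V x y) (hV : ∀ x, ∑ y, V x y = 1)
    (hpQ : ∀ z, Q z = ∑ x, p x * ∑ y, V x y * W x y z) :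
    ∃ (c : Code X₁ X₂ K₁ K₂ n) (D : ℝ), kl (c.outputDist W) (iidDist n Q) = D ∧ 0 ≤ D ∧
      D ≤ ((∑ a : Fin n → X₁, ∑ b : Fin n → X₂, ∑ c : Fin n → Z,
          (∏ i, p (a i) * V (a i) (b i) * W (a i) (b i) (c i)) *
            Real.log (1 + (∏ i, (∑ y, V (a i) y * W (a i) y (c i)) / Q (c i)) / K₁))
        + (∑ a : Fin n → X₁, ∑ b : Fin n → X₂, ∑ c : Fin n → Z,
          (∏ i, p (a i) * V (a i) (b i) * W (a i) (b i) (c i)) *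
            Real.log (1 + (∏ i, p (a i) * W (a i) (b i) (c i) / Q (c i)) / K₂))
        + (∑ a : Fin n → X₁, ∑ b : Fin n → X₂, ∑ c : Fin n → Z,
          (∏ i, p (a i) * V (a i) (b i) * W (a i) (b i) (c i)) *
            Real.log (1 + (∏ i, W (a i) (b i) (c i) / Q (c i)) / (K₁ * K₂)))) / Real.log 2 := by
  classical
  have hW0 : ∀ x y z, 0 ≤ W x y z := fun x y => (hW x y).1
  obtain ⟨u, v, huv, hD⟩ := exists_codebook hK₁ hK₂ (fun a : Fin n → X₁ => ∏ i, p (a i))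
    (fun a (b : Fin n → X₂) => ∏ i, V (a i) (b i))
    (fun a b (c : Fin n → Z) => ∏ i, W (a i) (b i) (c i)) (iidDist n Q)
    (fun _ => prod_nonneg fun _ _ => hp0 _) (sum_prod_eq_one (fun _ => p) fun _ => hp)
    (fun _ _ => prod_nonneg fun _ _ => hV0 _ _)
    (fun a => sum_prod_eq_one (fun i => V (a i)) fun _ => hV _)
    (fun _ _ _ => prod_nonneg fun _ _ => hW0 _ _ _) (fun a b => sum_channel_prod W hW a b)
    (fun c => by
      simp_rw [← Finset.prod_mul_distrib]
      rw [Finset.sum_congr rfl fun a _ => congrArg ((∏ i, p (a i)) * ·)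
        (sum_prod_apply (fun i y => V (a i) y * W (a i) y (c i)))]
      simp_rw [← Finset.prod_mul_distrib]
      rw [sum_prod_apply (fun i x => p x * ∑ y, V x y * W x y (c i))]
      exact prod_congr rfl fun i _ => hpQ _)
  -- Satellites indexed by the value of the whole first word are exactly what non-causal cribbing
  -- permits.
  let c : Code X₁ X₂ K₁ K₂ n := ⟨fun i m => u m i, fun i m x => v (x, m) i⟩
  have hac : ∀ z, iidDist n Q z = 0 → c.outputDist W z = 0 := by
    intro z hz
    have : ∀ m₁ m₂, ∏ i, W (c.word₁ m₁ i) (c.word₂ m₁ m₂ i) (z i) = 0 := huv z hz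
    simp [Code.outputDist, this]
  refine ⟨c, _, kl_eq_of_absCont hac, sum_mul_logb_div_nonneg _ _ (outputDist_mem hK₁ hK₂ W hW c)
    (iidDist_mem n Q hQ) hac, hD.trans ?_⟩
  have hl2 : 0 < Real.log 2 := Real.log_pos one_lt_two
  rw [le_div_iff₀ hl2]
  simp_rw [← Finset.sum_add_distrib, Finset.mul_sum, Finset.sum_mul]
  refine sum_le_sum fun a _ => sum_le_sum fun b _ => sum_le_sum fun z _ => ?_
  rw [← mul_assoc, ← mul_assoc, ← mul_add, ← mul_add, mul_assoc _ _ (Real.log 2),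
    Finset.prod_mul_distrib, Finset.prod_mul_distrib]
  refine mul_le_mul_of_nonneg_left ?_ (mul_nonneg (mul_nonneg (prod_nonneg fun _ _ => hp0 _)
    (prod_nonneg fun _ _ => hV0 _ _)) (prod_nonneg fun _ _ => hW0 _ _ _))
  rw [Real.logb, div_mul_cancel₀ _ hl2.ne']
  have e1 : (∑ b' : Fin n → X₂, (∏ i, V (a i) (b' i)) * ∏ i, W (a i) (b' i) (z i))
      / (K₁ * iidDist n Q z) = (∏ i, (∑ y, V (a i) y * W (a i) y (z i)) / Q (z i)) / K₁ := by
    simp_rw [← Finset.prod_mul_distrib]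
    rw [sum_prod_apply (fun i y => V (a i) y * W (a i) y (z i)), Finset.prod_div_distrib, div_div,
      mul_comm (K₁ : ℝ)]
    rfl
  have e2 : (∏ i, p (a i)) * (∏ i, W (a i) (b i) (z i)) / (K₂ * iidDist n Q z)
      = (∏ i, p (a i) * W (a i) (b i) (z i) / Q (z i)) / K₂ := by
    rw [← Finset.prod_mul_distrib, Finset.prod_div_distrib, div_div, mul_comm (K₂ : ℝ)]
    rfl
  have e3 : (∏ i, W (a i) (b i) (z i)) / (K₁ * K₂ * iidDist n Q z)
      = (∏ i, W (a i) (b i) (z i) / Q (z i)) / (K₁ * K₂) := by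
    rw [Finset.prod_div_distrib, div_div, mul_comm (K₁ * K₂ : ℝ)]
    rfl
  have q1 : 0 ≤ (∏ i, (∑ y, V (a i) y * W (a i) y (z i)) / Q (z i)) / (K₁ : ℝ) :=
    div_nonneg (prod_nonneg fun i _ => div_nonneg (sum_nonneg fun y _ =>
      mul_nonneg (hV0 _ _) (hW0 _ _ _)) (hQ.1 _)) (Nat.cast_nonneg _)
  have q2 : 0 ≤ (∏ i, p (a i) * W (a i) (b i) (z i) / Q (z i)) / (K₂ : ℝ) :=
    div_nonneg (prod_nonneg fun i _ => div_nonneg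
      (mul_nonneg (hp0 _) (hW0 _ _ _)) (hQ.1 _)) (Nat.cast_nonneg _)
  have q3 : 0 ≤ (∏ i, W (a i) (b i) (z i) / Q (z i)) / (K₁ * K₂ : ℝ) :=
    div_nonneg (prod_nonneg fun i _ => div_nonneg (hW0 _ _ _) (hQ.1 _)) (by positivity)
  simp only [coverRatio]
  rw [e1, e2, e3]
  set x := (∏ i, (∑ y, V (a i) y * W (a i) y (z i)) / Q (z i)) / (K₁ : ℝ)
  set y := (∏ i, p (a i) * W (a i) (b i) (z i) / Q (z i)) / (K₂ : ℝ)
  set t := (∏ i, W (a i) (b i) (z i) / Q (z i)) / (K₁ * K₂ : ℝ)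
  -- The inequality `1 + x + y + t ≤ (1 + x) (1 + y) (1 + t)` splits the logarithm into one term per
  -- rate constraint.
  rw [← Real.log_mul (by positivity) (by positivity), ← Real.log_mul (by positivity)
    (by positivity)]
  refine Real.log_le_log (by positivity) ?_
  nlinarith [mul_nonneg q1 q2, mul_nonneg q1 q3, mul_nonneg q2 q3, mul_nonneg (mul_nonneg q1 q2) q3]

theorem achievable_of_lt (W : X₁ → X₂ → Z → ℝ) (hW : IsChannel W) (Q : Z → ℝ)
    (hQ : Q ∈ stdSimplex ℝ Z) (P : X₁ × X₂ → ℝ) (hP : P ∈ stdSimplex ℝ (X₁ × X₂))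
    (hPQ : sndMarginal (jointDist P W) = Q) (R : ℝ × ℝ) (hR₁ : 0 ≤ R.1) (hR₂ : 0 ≤ R.2)
    (h₁ : mutualInfo (jointDistFst P W) < R.1)
    (h₂ : mutualInfo (jointDist P W) - entropy (fstMarginal P) < R.2)
    (h₁₂ : mutualInfo (jointDist P W) < R.1 + R.2) : Achievable W Q R := by
  have hW0 : ∀ x y z, 0 ≤ W x y z := fun x y => (hW x y).1
  obtain ⟨V, hV0, hV, hPV⟩ := exists_conditional P hP
  set p := fstMarginal P with hp_def
  have hp := fstMarginal_mem P hP
  rw [← hp_def] at hp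
  have hpQ : ∀ z, Q z = ∑ x, p x * ∑ y, V x y * W x y z := by
    intro z
    rw [← hPQ]
    simp only [Finset.mul_sum, ← mul_assoc, hPV, sndMarginal, jointDist, Fintype.sum_prod_type]
  choose c D hcD hD0 hD using fun n => exists_code (n := n) (numMessages_pos hR₁ n)
    (numMessages_pos hR₂ n) W hW Q hQ p V hp.1 hp.2 hV0 hV hpQ
  refine ⟨hR₁, hR₂, c, ?_⟩
  simp_rw [hcD]
  rw [← EReal.coe_zero, EReal.tendsto_coe]
  refine squeeze_zero hD0 hD ?_
  have hw0 : ∀ x y z, 0 ≤ p x * V x y * W x y z := fun x y z =>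
    mul_nonneg (mul_nonneg (hp.1 x) (hV0 x y)) (hW0 x y z)
  have hw1 : ∑ x, ∑ y, ∑ z, p x * V x y * W x y z = 1 := by
    simp_rw [← Finset.mul_sum, (hW _ _).2, mul_one, ← Finset.mul_sum, hV, mul_one, hp.2]
  have hf1 : ∀ x y z, p x * V x y * W x y z ≠ 0 → 0 < ∑ y', V x y' * W x y' z := fun x y z h =>
    ((mul_nonneg (hV0 x y) (hW0 x y z)).lt_of_ne' (by
      rw [mul_assoc] at h
      exact right_ne_zero_of_mul h)).trans_le
    (single_le_sum (f := fun y' => V x y' * W x y' z)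
      (fun y' _ => mul_nonneg (hV0 x y') (hW0 x y' z)) (mem_univ y))
  have hp' : ∀ x y z, p x * V x y * W x y z ≠ 0 → 0 < p x := fun x y z h =>
    (hp.1 x).lt_of_ne' (left_ne_zero_of_mul (left_ne_zero_of_mul h))
  have hW' : ∀ x y z, p x * V x y * W x y z ≠ 0 → 0 < W x y z := fun x y z h =>
    (hW0 x y z).lt_of_ne' (right_ne_zero_of_mul h)
  have hQ' : ∀ x y z, p x * V x y * W x y z ≠ 0 → 0 < Q z := fun x y z h => by
    rw [hpQ]
    exact (mul_pos (hp' x y z h) (hf1 x y z h)).trans_le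
      (single_le_sum (f := fun x => p x * ∑ y', V x y' * W x y' z)
        (fun x _ => mul_nonneg (hp.1 x) (sum_nonneg fun y' _ =>
          mul_nonneg (hV0 x y') (hW0 x y' z))) (mem_univ x))
  have hI := mutualInfo_jointDist P W hW
  have hI₁ := mutualInfo_jointDistFst P W hW V hV hPV
  rw [hPQ] at hI hI₁
  have t1 := tendsto_sum_log_one_add (fun x y z => p x * V x y * W x y z)
    (fun x _ z => (∑ y', V x y' * W x y' z) / Q z) hw0 hw1
    (fun x y z => div_nonneg (sum_nonneg fun y' _ => mul_nonneg (hV0 _ _) (hW0 _ _ _)) (hQ.1 _))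
    (fun x y z h => div_pos (hf1 x y z h) (hQ' x y z h)) (R := R.1)
    (by simp_rw [hPV]; rwa [← hI₁]) (fun n => numMessages R.1 n) (fun n => by
      have := half_le_numMessages hR₁ n
      have := one_le_two_rpow hR₁ n
      linarith)
  -- The collision term: the extra factor `p x` contributes the mean of `log p(X₁)`, that is
  -- `-H(X₁)`.
  have t2 := tendsto_sum_log_one_add (fun x y z => p x * V x y * W x y z)
    (fun x y z => p x * W x y z / Q z) hw0 hw1
    (fun x y z => div_nonneg (mul_nonneg (hp.1 _) (hW0 _ _ _)) (hQ.1 _))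
    (fun x y z h => div_pos (mul_pos (hp' x y z h) (hW' x y z h)) (hQ' x y z h)) (R := R.2)
    (by
      refine lt_of_eq_of_lt ?_ h₂
      have hH : -entropy p = ∑ x, ∑ y, ∑ z, p x * V x y * W x y z * Real.logb 2 (p x) := by
        simp_rw [← Finset.sum_mul, ← Finset.mul_sum, (hW _ _).2, mul_one, ← Finset.mul_sum, hV,
          mul_one]
        simp [entropy]
      rw [hI, sub_eq_add_neg, hH]
      simp_rw [hPV, ← Finset.sum_add_distrib]
      refine sum_congr rfl fun x _ => sum_congr rfl fun y _ => sum_congr rfl fun z _ => ?_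
      by_cases h : P (x, y) * W x y z = 0
      · simp [h]
      · rw [← hPV] at h
        rw [mul_div_assoc, Real.logb_mul (hp' x y z h).ne'
          (div_pos (hW' x y z h) (hQ' x y z h)).ne']
        ring) (fun n => numMessages R.2 n) (fun n => by
      have := half_le_numMessages hR₂ n
      have := one_le_two_rpow hR₂ n
      linarith)
  -- Each count loses at most a factor of two to the floor, so the product keeps a quarter of `2 ^
  -- (n (R₁ + R₂))`.
  have t3 := tendsto_sum_log_one_add (fun x y z => p x * V x y * W x y z)
    (fun x y z => W x y z / Q z) hw0 hw1
    (fun x y z => div_nonneg (hW0 _ _ _) (hQ.1 _))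
    (fun x y z h => div_pos (hW' x y z h) (hQ' x y z h)) (R := R.1 + R.2)
    (by simp_rw [hPV]; rwa [← hI]) (fun n => numMessages R.1 n * numMessages R.2 n) (fun n => by
      have h1 := half_le_numMessages hR₁ n
      have h2 := half_le_numMessages hR₂ n
      have h3 := one_le_two_rpow hR₁ n
      have h4 := one_le_two_rpow hR₂ n
      rw [mul_add, Real.rpow_add two_pos]
      nlinarith)
  simpa using ((t1.add t2).add t3).div_const (Real.log 2)

end Achievability

/-! ### Single-letterization through average letter frequencies. -/

section TimeSharing

variable {M S Z : Type*} [Fintype M] [Fintype S] [Fintype Z] {n : ℕ}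

/-- The output distribution when the word `x m` is sent with probability `w m`. -/
def mixture (w : M → ℝ) (x : M → Fin n → S) (U : S → Z → ℝ) (z : Fin n → Z) : ℝ :=
  ∑ m, w m * ∏ i, U (x m i) (z i)

open Classical in
/-- The expected letter frequency of a random word: the law of a uniformly chosen coordinate. -/
noncomputable def letterFreq (w : M → ℝ) (x : M → Fin n → S) (s : S) : ℝ :=
  (∑ m, ∑ i, w m * if x m i = s then 1 else 0) / n

omit [Fintype S] [Fintype Z] in
lemma letterFreq_nonneg (w : M → ℝ) (hw : ∀ m, 0 ≤ w m) (x : M → Fin n → S) (s : S) :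
    0 ≤ letterFreq w x s :=
  div_nonneg (sum_nonneg fun m _ => sum_nonneg fun i _ =>
    mul_nonneg (hw m) (by split_ifs <;> norm_num)) (Nat.cast_nonneg _)

omit [Fintype S] [Fintype Z] in
lemma letterFreq_pos (w : M → ℝ) (hw : ∀ m, 0 ≤ w m) (x : M → Fin n → S) {m : M} (i : Fin n)
    (hm : w m ≠ 0) : 0 < letterFreq w x (x m i) := by
  classical
  have h0 : ∀ m' i', 0 ≤ w m' * if x m' i' = x m i then (1 : ℝ) else 0 := fun m' i' =>
    mul_nonneg (hw m') (by split_ifs <;> norm_num)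
  refine div_pos ?_ (Nat.cast_pos.2 i.pos)
  have h1 := single_le_sum (f := fun i' => w m * if x m i' = x m i then (1 : ℝ) else 0)
    (fun i' _ => h0 m i') (mem_univ i)
  have h2 := single_le_sum (f := fun m' => ∑ i', w m' * if x m' i' = x m i then (1 : ℝ) else 0)
    (fun m' _ => sum_nonneg fun i' _ => h0 m' i') (mem_univ m)
  simp only [if_true, mul_one] at h1
  have h3 : 0 < ∑ m', ∑ i', w m' * if x m' i' = x m i then (1 : ℝ) else 0 :=
    ((hw m).lt_of_ne' hm).trans_le (h1.trans h2)
  convert h3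

omit [Fintype Z] in
lemma sum_letterFreq_mul (hn : 0 < n) (w : M → ℝ) (x : M → Fin n → S) (ψ : S → ℝ) :
    n * ∑ s, letterFreq w x s * ψ s = ∑ m, ∑ i, w m * ψ (x m i) := by
  classical
  have hn' : (n : ℝ) ≠ 0 := Nat.cast_ne_zero.2 hn.ne'
  have e : ∀ s, (n : ℝ) * (letterFreq w x s * ψ s)
      = ∑ m, ∑ i, w m * if x m i = s then ψ s else 0 := by
    intro s
    have : (n : ℝ) * (letterFreq w x s * ψ s)
        = (∑ m, ∑ i, w m * if x m i = s then 1 else 0) * ψ s := by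
      unfold letterFreq
      rw [← mul_assoc, mul_div_cancel₀ _ hn']
    rw [this]
    simp_rw [Finset.sum_mul, mul_assoc, ite_mul, one_mul, zero_mul]
  rw [Finset.mul_sum, Finset.sum_congr rfl fun s _ => e s, Finset.sum_comm]
  refine sum_congr rfl fun m _ => ?_
  rw [Finset.sum_comm]
  refine sum_congr rfl fun i _ => ?_
  rw [← Finset.mul_sum]
  simp

omit [Fintype Z] in
lemma letterFreq_mem (hn : 0 < n) (w : M → ℝ) (hw : w ∈ stdSimplex ℝ M) (x : M → Fin n → S) :
    letterFreq w x ∈ stdSimplex ℝ S := by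
  have hn' : (n : ℝ) ≠ 0 := Nat.cast_ne_zero.2 hn.ne'
  refine ⟨letterFreq_nonneg w hw.1 x, ?_⟩
  have := sum_letterFreq_mul hn w x (fun _ => 1)
  simp only [mul_one, sum_const, card_univ, Fintype.card_fin, nsmul_eq_mul, ← Finset.mul_sum,
    hw.2] at this
  exact mul_left_cancel₀ hn' (by rw [this, mul_one])

/-- Given the word, each output letter depends on its own input letter alone, so the mean of an
additive function sees the code only through its letter frequencies. -/
lemma sum_mixture_mul_sum (hn : 0 < n) (w : M → ℝ) (x : M → Fin n → S) (U : S → Z → ℝ)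
    (hU : ∀ s, ∑ z, U s z = 1) (φ : S → Z → ℝ) :
    ∑ m, ∑ z : Fin n → Z, w m * (∏ i, U (x m i) (z i)) * ∑ i, φ (x m i) (z i)
      = n * ∑ s, ∑ z, letterFreq w x s * U s z * φ s z := by
  have := sum_letterFreq_mul hn w x (fun s => ∑ z, U s z * φ s z)
  simp_rw [Finset.mul_sum (s := (univ : Finset Z)), ← mul_assoc] at this
  rw [this]
  refine sum_congr rfl fun m _ => ?_
  simp_rw [Finset.mul_sum (s := (univ : Finset (Fin n)))]
  rw [Finset.sum_comm]
  refine sum_congr rfl fun i _ => ?_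
  simp_rw [mul_assoc]
  rw [← Finset.mul_sum, ← Finset.mul_sum,
    sum_prod_mul_apply (fun i => U (x m i)) (fun i => hU _) i (φ (x m i))]

omit [Fintype S] in
lemma sum_mixture (w : M → ℝ) (hw : ∑ m, w m = 1) (x : M → Fin n → S) (U : S → Z → ℝ)
    (hU : ∀ s, ∑ z, U s z = 1) :
    ∑ m, ∑ z : Fin n → Z, w m * ∏ i, U (x m i) (z i) = 1 := by
  simp_rw [← Finset.mul_sum, fun m => sum_prod_eq_one (fun i => U (x m i)) fun i => hU _, mul_one,
    hw]

/-- If the words are indexed by `k`, a subprobability `q (k m) z = κ * ∏ φ` is no better a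
predictor than the output distribution itself. -/
lemma sum_letterFreq_logb_le (hn : 0 < n) (w : M → ℝ) (hw : w ∈ stdSimplex ℝ M)
    (x : M → Fin n → S) (U : S → Z → ℝ) (hU : ∀ s, U s ∈ stdSimplex ℝ Z) (Q : Z → ℝ)
    (hQ0 : ∀ z, 0 ≤ Q z) (hac : ∀ z, iidDist n Q z = 0 → mixture w x U z = 0)
    {Y : Type*} [Fintype Y] (k : M → Y) (q : Y → (Fin n → Z) → ℝ) (hq0 : ∀ y z, 0 ≤ q y z)
    (hq1 : ∑ y, ∑ z, q y z ≤ 1) {κ : ℝ} (hκ : 0 < κ) (φ : S → Z → ℝ)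
    (hφ : ∀ m i z, w m ≠ 0 → U (x m i) z ≠ 0 → 0 < φ (x m i) z)
    (hqk : ∀ m z, q (k m) z = κ * ∏ i, φ (x m i) (z i)) :
    n * (∑ s, ∑ z, letterFreq w x s * U s z * Real.logb 2 (φ s z / Q z)) + Real.logb 2 κ
      ≤ ∑ z, mixture w x U z * Real.logb 2 (mixture w x U z / iidDist n Q z) := by
  classical
  have hl2 : 0 < Real.log 2 := Real.log_pos one_lt_two
  set J : M → (Fin n → Z) → ℝ := fun m z => w m * ∏ i, U (x m i) (z i) with hJ
  have hJ0 : ∀ m z, 0 ≤ J m z := fun m z => mul_nonneg (hw.1 m) (prod_nonneg fun i _ => (hU _).1 _)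
  have hJ1 : ∑ m, ∑ z, J m z = 1 := sum_mixture w hw.2 x U fun s => (hU s).2
  have hmix : ∀ z, mixture w x U z = ∑ m, J m z := fun z => rfl
  have hJle : ∀ m z, J m z ≤ mixture w x U z := fun m z =>
    single_le_sum (f := fun m => J m z) (fun m _ => hJ0 m z) (mem_univ m)
  have hpt : ∀ m z, J m z * (∑ i, Real.logb 2 (φ (x m i) (z i) / Q (z i))) + J m z * Real.logb 2 κ
      ≤ J m z * Real.logb 2 (mixture w x U z / iidDist n Q z)
        + (J m z * (q (k m) z / mixture w x U z) - J m z) / Real.log 2 := by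
    intro m z
    rcases (hJ0 m z).eq_or_lt with h0 | h0
    · simp [← h0]
    have hm : w m ≠ 0 := left_ne_zero_of_mul h0.ne'
    have hUz : ∀ i, U (x m i) (z i) ≠ 0 := fun i =>
      Finset.prod_ne_zero_iff.1 (right_ne_zero_of_mul h0.ne') i (mem_univ _)
    have hφz : ∀ i, 0 < φ (x m i) (z i) := fun i => hφ m i _ hm (hUz i)
    have hmp : 0 < mixture w x U z := h0.trans_le (hJle m z)
    have hQn : iidDist n Q z ≠ 0 := fun h => hmp.ne' (hac z h)
    have hQz : ∀ i, 0 < Q (z i) := fun i =>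
      (hQ0 _).lt_of_ne' (Finset.prod_ne_zero_iff.1 hQn i (mem_univ _))
    have hqp : 0 < q (k m) z := by
      rw [hqk]
      exact mul_pos hκ (prod_pos fun i _ => hφz i)
    have e : ∑ i, Real.logb 2 (φ (x m i) (z i) / Q (z i)) + Real.logb 2 κ
        = Real.logb 2 (mixture w x U z / iidDist n Q z)
          + Real.logb 2 (q (k m) z / mixture w x U z) := by
      rw [← Real.logb_prod _ _ (fun i _ => (div_pos (hφz i) (hQz i)).ne'), Finset.prod_div_distrib,
        ← Real.logb_mul (div_ne_zero (prod_pos fun i _ => hφz i).ne'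
          (prod_pos fun i _ => hQz i).ne') hκ.ne',
        ← Real.logb_mul (div_ne_zero hmp.ne' hQn) (div_ne_zero hqp.ne' hmp.ne'), hqk]
      congr 1
      unfold iidDist
      have := (prod_pos fun i (_ : i ∈ univ) => hQz i).ne'
      have := hmp.ne'
      field_simp
    rw [← mul_add, e, mul_add]
    refine add_le_add le_rfl ?_
    have h1 := logb_two_le_add (div_pos hqp hmp) one_pos
    rw [Real.logb_one, zero_add, div_one] at h1
    refine (mul_le_mul_of_nonneg_left h1 h0.le).trans (le_of_eq ?_)
    ring
  -- For a fixed output, the joint masses of the messages sharing a label add up to at most the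
  -- mixture, so each label contributes at most `q y z`.
  have hsum : ∑ m, ∑ z, J m z * (q (k m) z / mixture w x U z) ≤ 1 := by
    rw [Finset.sum_comm]
    rw [Finset.sum_comm] at hq1
    refine le_trans (sum_le_sum fun z _ => ?_) hq1
    rw [← Finset.sum_fiberwise univ k]
    refine sum_le_sum fun y _ => ?_
    have : ∑ m with k m = y, J m z * (q (k m) z / mixture w x U z)
        = q y z * ((∑ m with k m = y, J m z) / mixture w x U z) := by
      rw [Finset.sum_div, Finset.mul_sum]
      refine sum_congr rfl fun m hm => ?_
      rw [(mem_filter.1 hm).2]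
      ring
    rw [this]
    refine mul_le_of_le_one_right (hq0 y z) (div_le_one_of_le₀ ?_ ?_)
    · exact sum_le_sum_of_subset_of_nonneg (filter_subset _ _) fun m _ _ => hJ0 m z
    · exact sum_nonneg fun m _ => hJ0 m z
  have hR : ∑ z, mixture w x U z * Real.logb 2 (mixture w x U z / iidDist n Q z)
      = ∑ m, ∑ z, J m z * Real.logb 2 (mixture w x U z / iidDist n Q z) := by
    rw [Finset.sum_comm]
    refine sum_congr rfl fun z _ => ?_
    rw [← Finset.sum_mul]
    rfl
  rw [hR, ← sum_mixture_mul_sum hn w x U (fun s => (hU s).2) (fun s z => Real.logb 2 (φ s z / Q z))]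
  have h := sum_le_sum fun m (_ : m ∈ univ) => sum_le_sum fun z (_ : z ∈ univ) => hpt m z
  simp only [Finset.sum_add_distrib, ← Finset.sum_mul, ← Finset.sum_div,
    Finset.sum_sub_distrib, hJ1, one_mul] at h
  refine h.trans ?_
  have : (∑ m, ∑ z, J m z * (q (k m) z / mixture w x U z) - 1) / Real.log 2 ≤ 0 :=
    div_nonpos_of_nonpos_of_nonneg (by linarith) hl2.le
  linarith

/-- A block containing a letter outside the support of `Q` has product probability zero, hence
output probability zero; all other blocks contain no such letter. So the expected number of its
occurrences vanishes. -/
lemma sum_letterFreq_mul_eq_zero (hn : 0 < n) (w : M → ℝ) (hw : w ∈ stdSimplex ℝ M)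
    (x : M → Fin n → S) (U : S → Z → ℝ) (hU : ∀ s, U s ∈ stdSimplex ℝ Z) (Q : Z → ℝ)
    (hac : ∀ z, iidDist n Q z = 0 → mixture w x U z = 0) (z : Z) (hz : Q z = 0) :
    ∑ s, letterFreq w x s * U s z = 0 := by
  classical
  have hn' : (n : ℝ) ≠ 0 := Nat.cast_ne_zero.2 hn.ne'
  have h := sum_mixture_mul_sum hn w x U (fun s => (hU s).2) (fun _ z' => if z' = z then 1 else 0)
  simp only [mul_ite, mul_one, mul_zero, Finset.sum_ite_eq', mem_univ, if_true] at h
  refine (mul_eq_zero.1 (h.symm.trans ?_)).resolve_left hn'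
  refine sum_eq_zero fun m _ => sum_eq_zero fun c _ => ?_
  by_cases hc : ∃ i, c i = z
  · obtain ⟨i, hi⟩ := hc
    have h0 : mixture w x U c = 0 :=
      hac c (Finset.prod_eq_zero (mem_univ i) (by rw [hi, hz]))
    have h1 := (sum_eq_zero_iff_of_nonneg fun m _ =>
      mul_nonneg (hw.1 m) (prod_nonneg fun i _ => (hU _).1 _)).1 h0 m (mem_univ m)
    rw [h1, zero_mul]
  · push Not at hc
    simp [hc]

/-- Replacing `Q` by the single-letter output law `o` in the denominator lowers the left side by `n`
times the divergence of `o` from `Q`, which is nonnegative. -/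
lemma sum_letterFreq_logb_output_le (hn : 0 < n) (w : M → ℝ) (hw : w ∈ stdSimplex ℝ M)
    (x : M → Fin n → S) (U : S → Z → ℝ) (hU : ∀ s, U s ∈ stdSimplex ℝ Z) (Q : Z → ℝ)
    (hQ : Q ∈ stdSimplex ℝ Z) (hac : ∀ z, iidDist n Q z = 0 → mixture w x U z = 0)
    {Y : Type*} [Fintype Y] (k : M → Y) (q : Y → (Fin n → Z) → ℝ) (hq0 : ∀ y z, 0 ≤ q y z)
    (hq1 : ∑ y, ∑ z, q y z ≤ 1) {κ : ℝ} (hκ : 0 < κ) (φ : S → Z → ℝ)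
    (hφ : ∀ s z, letterFreq w x s ≠ 0 → U s z ≠ 0 → 0 < φ s z)
    (hqk : ∀ m z, q (k m) z = κ * ∏ i, φ (x m i) (z i)) :
    n * (∑ s, ∑ z, letterFreq w x s * U s z *
        Real.logb 2 (φ s z / ∑ s', letterFreq w x s' * U s' z)) + Real.logb 2 κ
      ≤ ∑ z, mixture w x U z * Real.logb 2 (mixture w x U z / iidDist n Q z) := by
  refine le_trans ?_ (sum_letterFreq_logb_le hn w hw x U hU Q hQ.1 hac k q hq0 hq1 hκ φ
    (fun m i z hm hz => hφ _ _ (letterFreq_pos w hw.1 x i hm).ne' hz) hqk)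
  set F := letterFreq w x with hF
  have hFm := letterFreq_mem hn w hw x
  rw [← hF] at hFm
  set o : Z → ℝ := fun z => ∑ s, F s * U s z with ho
  have ho0 : ∀ s z, F s * U s z ≤ o z := fun s z =>
    single_le_sum (f := fun s => F s * U s z)
      (fun s _ => mul_nonneg (hFm.1 s) ((hU s).1 z)) (mem_univ s)
  have hom : o ∈ stdSimplex ℝ Z := ⟨fun z => sum_nonneg fun s _ =>
    mul_nonneg (hFm.1 s) ((hU s).1 z), by
      simp only [ho]
      rw [Finset.sum_comm]
      simp_rw [← Finset.mul_sum, (hU _).2, mul_one, hFm.2]⟩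
  have hoQ : ∀ z, Q z = 0 → o z = 0 := sum_letterFreq_mul_eq_zero hn w hw x U hU Q hac
  have hD := sum_mul_logb_div_nonneg o Q hom hQ hoQ
  have e : ∑ s, ∑ z, F s * U s z * Real.logb 2 (φ s z / Q z)
      = ∑ s, ∑ z, F s * U s z * Real.logb 2 (φ s z / o z)
        + ∑ z, o z * Real.logb 2 (o z / Q z) := by
    rw [← sub_eq_iff_eq_add']
    simp_rw [← Finset.sum_sub_distrib]
    rw [Finset.sum_comm]
    refine sum_congr rfl fun z _ => ?_
    rw [ho]
    simp only
    rw [Finset.sum_mul]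
    refine sum_congr rfl fun s _ => ?_
    by_cases h : F s * U s z = 0
    · simp [h]
    have hp := hφ s z (left_ne_zero_of_mul h) (right_ne_zero_of_mul h)
    have hoz : 0 < o z := ((mul_nonneg (hFm.1 s) ((hU s).1 z)).lt_of_ne' h).trans_le (ho0 s z)
    have hQz : Q z ≠ 0 := fun hz => hoz.ne' (hoQ z hz)
    change F s * U s z * Real.logb 2 (φ s z / Q z) - F s * U s z * Real.logb 2 (φ s z / o z)
      = F s * U s z * Real.logb 2 (o z / Q z)
    rw [Real.logb_div hp.ne' hQz, Real.logb_div hp.ne' hoz.ne', Real.logb_div hoz.ne' hQz]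
    ring
  rw [e]
  gcongr
  linarith

end TimeSharing

/-! ### Converse: single-letter constraints imposed by a code. -/

section Converse

variable {X₁ X₂ Z : Type*} [Fintype X₁] [Fintype X₂] [Fintype Z]

/-- The single-letter inequalities that a code of length `n` imposes. -/
lemma exists_dist_of_code {K₁ K₂ n : ℕ} (hn : 0 < n) (hK₁ : 0 < K₁) (hK₂ : 0 < K₂)
    (W : X₁ → X₂ → Z → ℝ) (hW : IsChannel W) (Q : Z → ℝ) (hQ : Q ∈ stdSimplex ℝ Z)
    (c : Code X₁ X₂ K₁ K₂ n) (hac : ∀ z, iidDist n Q z = 0 → c.outputDist W z = 0) {D : ℝ}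
    (hD : D = ∑ z, c.outputDist W z * Real.logb 2 (c.outputDist W z / iidDist n Q z)) :
    ∃ P ∈ stdSimplex ℝ (X₁ × X₂),
      n * ∑ z, (√(sndMarginal (jointDist P W) z) - √(Q z)) ^ 2 ≤ Real.log 2 * D ∧
      n * mutualInfo (jointDistFst P W) ≤ Real.logb 2 K₁ + D ∧
      n * (mutualInfo (jointDist P W) - entropy (fstMarginal P)) ≤ Real.logb 2 K₂ + D ∧
      n * mutualInfo (jointDist P W) ≤ Real.logb 2 K₁ + Real.logb 2 K₂ + D := by
  have hl2 : 0 < Real.log 2 := Real.log_pos one_lt_two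
  have k1 : (0 : ℝ) < K₁ := Nat.cast_pos.2 hK₁
  have k2 : (0 : ℝ) < K₂ := Nat.cast_pos.2 hK₂
  have hW0 : ∀ x y z, 0 ≤ W x y z := fun x y => (hW x y).1
  let w : Fin K₁ × Fin K₂ → ℝ := fun _ => 1 / (K₁ * K₂)
  let x : Fin K₁ × Fin K₂ → Fin n → X₁ × X₂ := fun m i => (c.word₁ m.1 i, c.word₂ m.1 m.2 i)
  let U : X₁ × X₂ → Z → ℝ := fun s => W s.1 s.2
  have hw : w ∈ stdSimplex ℝ (Fin K₁ × Fin K₂) := by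
    refine ⟨fun _ => by positivity, ?_⟩
    simp only [w, sum_const, card_univ, Fintype.card_prod, Fintype.card_fin, nsmul_eq_mul]
    push_cast
    field_simp
  have hU : ∀ s, U s ∈ stdSimplex ℝ Z := fun s => hW s.1 s.2
  have hmix : mixture w x U = c.outputDist W := by
    funext z
    simp only [mixture, Code.outputDist, w, x, U, ← Finset.mul_sum, Fintype.sum_prod_type]
    ring
  rw [← hmix] at hD hac
  set P := letterFreq w x with hPdef
  have hP : P ∈ stdSimplex ℝ (X₁ × X₂) := letterFreq_mem hn w hw x
  obtain ⟨V, hV0, hV, hPV⟩ := exists_conditional P hP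
  set p := fstMarginal P with hp_def
  have hp : p ∈ stdSimplex ℝ X₁ := fstMarginal_mem P hP
  have hom : sndMarginal (jointDist P W) = fun z => ∑ s, P s * U s z := rfl
  have hp' : ∀ s, P s ≠ 0 → 0 < p s.1 := fun s hs => (hp.1 s.1).lt_of_ne' <|
    left_ne_zero_of_mul (b := V s.1 s.2) (by rwa [hPV])
  have hV' : ∀ s, P s ≠ 0 → 0 < V s.1 s.2 := fun s hs => (hV0 _ _).lt_of_ne' <|
    right_ne_zero_of_mul (a := p s.1) (by rwa [hPV])
  have hU' : ∀ s z, U s z ≠ 0 → 0 < U s z := fun s z h => ((hU s).1 z).lt_of_ne' h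
  have hI : mutualInfo (jointDist P W)
      = ∑ s, ∑ z, P s * U s z * Real.logb 2 (U s z / ∑ s', P s' * U s' z) := by
    rw [mutualInfo_jointDist P W hW, Fintype.sum_prod_type, hom]
  have hI₁ : mutualInfo (jointDistFst P W) = ∑ s, ∑ z, P s * U s z *
      Real.logb 2 ((∑ y', V s.1 y' * W s.1 y' z) / ∑ s', P s' * U s' z) := by
    rw [mutualInfo_jointDistFst P W hW V hV hPV, Fintype.sum_prod_type, hom]
  refine ⟨P, hP, ?_, ?_, ?_, ?_⟩
  -- Constant label, with the product of the single-letter output law as predictor: `n` times its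
  -- divergence from `Q` is at most `D`, and it dominates the squared Hellinger distance.
  · have hom' : sndMarginal (jointDist P W) ∈ stdSimplex ℝ Z := by
      rw [hom]
      refine ⟨fun z => sum_nonneg fun s _ => mul_nonneg (hP.1 s) ((hU s).1 z), ?_⟩
      rw [Finset.sum_comm]
      simp_rw [← Finset.mul_sum, (hU _).2, mul_one, hP.2]
    have h := sum_letterFreq_logb_le hn w hw x U hU Q hQ.1 hac (fun _ => ())
      (fun _ z => ∏ i, sndMarginal (jointDist P W) (z i))
      (fun _ _ => prod_nonneg fun _ _ => hom'.1 _)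
      (by simp [sum_prod_eq_one (fun _ : Fin n => sndMarginal (jointDist P W))
        (fun _ => hom'.2)]) one_pos (fun _ z => sndMarginal (jointDist P W) z)
      (fun m i z hm hz => by
        rw [hom]
        exact (mul_pos (letterFreq_pos w hw.1 x i hm) (hU' _ _ hz)).trans_le
          (single_le_sum (f := fun s => P s * U s z)
            (fun s _ => mul_nonneg (hP.1 s) ((hU s).1 z)) (mem_univ (x m i))))
      (fun m z => by rw [one_mul])
    rw [Real.logb_one, add_zero, ← hD, Finset.sum_comm] at h
    simp_rw [← Finset.sum_mul] at h
    have hG := sum_sqrt_sub_sq_le _ Q hom' hQ fun z hz => by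
      rw [hom]
      exact sum_letterFreq_mul_eq_zero hn w hw x U hU Q hac z hz
    calc _ ≤ (n : ℝ) * (Real.log 2 * ∑ z, sndMarginal (jointDist P W) z *
          Real.logb 2 (sndMarginal (jointDist P W) z / Q z)) := by gcongr
      _ = Real.log 2 * (n * ∑ z, sndMarginal (jointDist P W) z *
          Real.logb 2 (sndMarginal (jointDist P W) z / Q z)) := by ring
      _ ≤ _ := mul_le_mul_of_nonneg_left h hl2.le
  -- Label `m₁`: uniform guess of `m₁`, then the channel from `X₁` to `Z` induced by `P`.
  · have h := sum_letterFreq_logb_output_le hn w hw x U hU Q hQ hac Prod.fst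
      (fun m₁ z => 1 / K₁ * ∏ i, ∑ y', V (c.word₁ m₁ i) y' * W (c.word₁ m₁ i) y' (z i))
      (fun m₁ z => mul_nonneg (by positivity) (prod_nonneg fun i _ => sum_nonneg fun y' _ =>
        mul_nonneg (hV0 _ _) (hW0 _ _ _)))
      (by
        simp_rw [← Finset.mul_sum, fun m₁ : Fin K₁ => sum_prod_eq_one
          (fun i z => ∑ y', V (c.word₁ m₁ i) y' * W (c.word₁ m₁ i) y' z) (fun i => by
            rw [Finset.sum_comm]
            simp_rw [← Finset.mul_sum, (hW _ _).2, mul_one, hV])]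
        simp [k1.ne'])
      (κ := 1 / K₁) (by positivity) (fun s z => ∑ y', V s.1 y' * W s.1 y' z)
      (fun s z hs hz => (mul_pos (hV' s hs) (hU' s z hz)).trans_le
        (single_le_sum (f := fun y' => V s.1 y' * W s.1 y' z)
          (fun y' _ => mul_nonneg (hV0 _ _) (hW0 _ _ _)) (mem_univ s.2)))
      (fun m z => rfl)
    rw [← hD, ← hPdef, ← hI₁, one_div, Real.logb_inv] at h
    linarith
  -- Label `(x₁^n, m₂)`, which determines the second word. The predictor weighs all words `x₁^n` by
  -- `p^n` and `m₂` uniformly, so its mass is one; the factor `p` produces `-H(X₁)`.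
  · have h := sum_letterFreq_logb_output_le hn w hw x U hU Q hQ hac
      (fun m => (c.word₁ m.1, m.2))
      (fun y z => 1 / K₂ * ∏ i, p (y.1 i) * W (y.1 i) (c.enc₂ i y.2 y.1) (z i))
      (fun m₁ z => mul_nonneg (by positivity) (prod_nonneg fun i _ =>
        mul_nonneg (hp.1 _) (hW0 _ _ _)))
      (by
        simp_rw [Finset.prod_mul_distrib, ← Finset.mul_sum, Fintype.sum_prod_type,
          fun (a : Fin n → X₁) (m₂ : Fin K₂) =>
            sum_channel_prod W hW a (fun i => c.enc₂ i m₂ a)]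
        simp [k2.ne', ← Finset.mul_sum, sum_prod_eq_one (fun _ : Fin n => p) (fun _ => hp.2)])
      (κ := 1 / K₂) (by positivity) (fun s z => p s.1 * U s z)
      (fun s z hs hz => mul_pos (hp' s hs) (hU' s z hz))
      (fun m z => rfl)
    have e : mutualInfo (jointDist P W) - entropy p = ∑ s, ∑ z, P s * U s z *
        Real.logb 2 (p s.1 * U s z / ∑ s', P s' * U s' z) := by
      have hH : -entropy p = ∑ s, ∑ z, P s * U s z * Real.logb 2 (p s.1) := by
        simp_rw [← Finset.sum_mul, ← Finset.mul_sum, (hU _).2, mul_one, Fintype.sum_prod_type,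
          ← Finset.sum_mul]
        simp only [entropy, neg_neg]
        rfl
      rw [sub_eq_add_neg, hI, hH]
      simp_rw [← Finset.sum_add_distrib]
      refine sum_congr rfl fun s _ => sum_congr rfl fun z _ => ?_
      by_cases h0 : P s * U s z = 0
      · simp [h0]
      have hs := left_ne_zero_of_mul h0
      have hz := right_ne_zero_of_mul h0
      have ho : 0 < ∑ s', P s' * U s' z :=
        ((mul_nonneg (hP.1 s) ((hU s).1 z)).lt_of_ne' h0).trans_le
          (single_le_sum (f := fun s => P s * U s z)
            (fun s _ => mul_nonneg (hP.1 s) ((hU s).1 z)) (mem_univ s))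
      rw [mul_div_assoc, Real.logb_mul (hp' s hs).ne' (div_pos (hU' s z hz) ho).ne']
      ring
    rw [← hD, ← hPdef, ← e, one_div, Real.logb_inv] at h
    linarith
  -- Label `(m₁, m₂)`: the predictor is the true joint law of messages and output.
  · have h := sum_letterFreq_logb_output_le hn w hw x U hU Q hQ hac id
      (fun m z => 1 / (K₁ * K₂) * ∏ i, U (x m i) (z i))
      (fun m₁ z => mul_nonneg (by positivity) (prod_nonneg fun i _ => (hU _).1 _))
      (sum_mixture w hw.2 x U fun s => (hU s).2).le
      (κ := 1 / (K₁ * K₂)) (by positivity) U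
      (fun s z _ hz => hU' s z hz) (fun m z => rfl)
    rw [← hD, ← hPdef, ← hI, one_div, Real.logb_inv, Real.logb_mul k1.ne' k2.ne'] at h
    linarith

lemma logb_numMessages_le {R : ℝ} (hR : 0 ≤ R) (n : ℕ) :
    Real.logb 2 (numMessages R n) ≤ n * R := by
  rw [Real.logb_le_iff_le_rpow one_lt_two (Nat.cast_pos.2 (numMessages_pos hR n))]
  exact numMessages_le R n

lemma exists_dist_of_achievable (W : X₁ → X₂ → Z → ℝ) (hW : IsChannel W) (Q : Z → ℝ)
    (hQ : Q ∈ stdSimplex ℝ Z) (R : ℝ × ℝ) (hR : Achievable W Q R) {ε : ℝ} (hε : 0 < ε) :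
    ∃ P ∈ stdSimplex ℝ (X₁ × X₂),
      ∑ z, (√(sndMarginal (jointDist P W) z) - √(Q z)) ^ 2 ≤ ε ∧
      mutualInfo (jointDistFst P W) ≤ R.1 + ε ∧
      mutualInfo (jointDist P W) - entropy (fstMarginal P) ≤ R.2 + ε ∧
      mutualInfo (jointDist P W) ≤ R.1 + R.2 + ε := by
  obtain ⟨hR₁, hR₂, c, hc⟩ := hR
  have h1 : ∀ᶠ n in atTop, kl ((c n).outputDist W) (iidDist n Q) < (ε : EReal) :=
    hc.eventually (gt_mem_nhds (by exact_mod_cast hε))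
  obtain ⟨n, hn, hn1⟩ := (h1.and (eventually_ge_atTop 1)).exists
  have hac : ∀ z, iidDist n Q z = 0 → (c n).outputDist W z = 0 := by
    by_contra h
    rw [kl, if_neg h] at hn
    exact not_top_lt hn
  rw [kl_eq_of_absCont hac, EReal.coe_lt_coe_iff] at hn
  obtain ⟨P, hP, a0, a1, a2, a3⟩ := exists_dist_of_code hn1 (numMessages_pos hR₁ n)
    (numMessages_pos hR₂ n) W hW Q hQ (c n) hac rfl
  have b1 := logb_numMessages_le hR₁ n
  have b2 := logb_numMessages_le hR₂ n
  have hn' : (1 : ℝ) ≤ n := by exact_mod_cast hn1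
  have hn0 : (0 : ℝ) < n := by linarith
  -- After division by `n ≥ 1`, an error below `ε` remains below `ε`.
  have hnε : ε ≤ n * ε := by nlinarith
  refine ⟨P, hP, le_of_mul_le_mul_left ?_ hn0, le_of_mul_le_mul_left ?_ hn0,
    le_of_mul_le_mul_left ?_ hn0, le_of_mul_le_mul_left ?_ hn0⟩
  · refine a0.trans (le_trans ?_ hnε)
    have hl2 : 0 < Real.log 2 := Real.log_pos one_lt_two
    have hl2' : Real.log 2 ≤ 1 := by linarith [Real.log_two_lt_d9]
    nlinarith
  all_goals linarith

end Converse

/-! ### Continuity of the information quantities. -/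

section Continuity

variable {A B : Type*} [Fintype A] [Fintype B]

lemma continuous_entropy : Continuous (entropy : (A → ℝ) → ℝ) := by
  have h : Continuous fun t : ℝ => t * Real.logb 2 t := by
    simpa only [Real.logb, mul_div_assoc] using Real.continuous_mul_log.div_const (Real.log 2)
  exact (continuous_finsetSum _ fun x _ => h.comp (continuous_apply x)).neg

/-- The quotient form hides continuity where masses vanish; entropies are continuous everywhere
because `t log t` is continuous at zero. -/
lemma mutualInfo_eq_entropy (J : A × B → ℝ) (hJ : ∀ q, 0 ≤ J q) :
    mutualInfo J = entropy (fstMarginal J) + entropy (sndMarginal J) - entropy J := by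
  have h1 : entropy (fstMarginal J) = -∑ a, ∑ b, J (a, b) * Real.logb 2 (fstMarginal J a) := by
    simp_rw [← Finset.sum_mul]
    rfl
  have h2 : entropy (sndMarginal J) = -∑ a, ∑ b, J (a, b) * Real.logb 2 (sndMarginal J b) := by
    rw [Finset.sum_comm]
    simp_rw [← Finset.sum_mul]
    rfl
  have h3 : entropy J = -∑ a, ∑ b, J (a, b) * Real.logb 2 (J (a, b)) := by
    rw [entropy, Fintype.sum_prod_type]
  rw [h1, h2, h3, ← neg_add, sub_neg_eq_add, neg_add_eq_sub]
  simp_rw [← Finset.sum_add_distrib, ← Finset.sum_sub_distrib]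
  refine sum_congr rfl fun a _ => sum_congr rfl fun b _ => ?_
  rcases (hJ (a, b)).eq_or_lt with h | h
  · simp [← h]
  have ha : 0 < fstMarginal J a := h.trans_le
    (single_le_sum (f := fun b => J (a, b)) (fun b _ => hJ _) (mem_univ b))
  have hb : 0 < sndMarginal J b := h.trans_le
    (single_le_sum (f := fun a => J (a, b)) (fun a _ => hJ _) (mem_univ a))
  rw [Real.logb_div h.ne' (mul_pos ha hb).ne', Real.logb_mul ha.ne' hb.ne']
  ring

lemma continuousOn_mutualInfo : ContinuousOn (mutualInfo : (A × B → ℝ) → ℝ) {J | ∀ q, 0 ≤ J q} := by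
  have h : Continuous fun J : A × B → ℝ =>
      entropy (fstMarginal J) + entropy (sndMarginal J) - entropy J := by
    have h1 : Continuous (fstMarginal : (A × B → ℝ) → A → ℝ) :=
      continuous_pi fun a => continuous_finsetSum _ fun b _ => continuous_apply (a, b)
    have h2 : Continuous (sndMarginal : (A × B → ℝ) → B → ℝ) :=
      continuous_pi fun b => continuous_finsetSum _ fun a _ => continuous_apply (a, b)
    exact ((continuous_entropy.comp h1).add (continuous_entropy.comp h2)).sub continuous_entropy
  exact h.continuousOn.congr fun J hJ => mutualInfo_eq_entropy J hJ

end Continuity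

/-! ### The two inclusions. -/

section Region

variable {X₁ X₂ Z : Type*} [Fintype X₁] [Fintype X₂] [Fintype Z]

/-- The single-letter region. -/
def singleLetterRegion (W : X₁ → X₂ → Z → ℝ) (Q : Z → ℝ) : Set (ℝ × ℝ) :=
  {R : ℝ × ℝ | 0 ≤ R.1 ∧ 0 ≤ R.2 ∧
    ∃ P ∈ stdSimplex ℝ (X₁ × X₂),
      sndMarginal (jointDist P W) = Q ∧
      mutualInfo (jointDistFst P W) ≤ R.1 ∧
      mutualInfo (jointDist P W) - entropy (fstMarginal P) ≤ R.2 ∧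
      mutualInfo (jointDist P W) ≤ R.1 + R.2}

lemma singleLetterRegion_subset (W : X₁ → X₂ → Z → ℝ) (hW : IsChannel W) (Q : Z → ℝ)
    (hQ : Q ∈ stdSimplex ℝ Z) : singleLetterRegion W Q ⊆ resolvabilityRegion W Q := by
  rintro R ⟨hR₁, hR₂, P, hP, hPQ, h1, h2, h3⟩
  -- Raising both rates by `ε` makes all three inequalities strict, and the closure absorbs the
  -- limit.
  have hlim : Tendsto (fun ε : ℝ => (R.1 + ε, R.2 + ε)) (𝓝[>] 0) (𝓝 R) := by
    have : Continuous fun ε : ℝ => (R.1 + ε, R.2 + ε) := by fun_prop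
    simpa using (this.tendsto 0).mono_left nhdsWithin_le_nhds
  refine mem_closure_of_tendsto hlim ?_
  filter_upwards [self_mem_nhdsWithin] with ε (hε : 0 < ε)
  refine achievable_of_lt W hW Q hQ P hP hPQ _ ?_ ?_ ?_ ?_ ?_ <;> dsimp only <;> linarith

/-- Approximating achievable pairs carry distributions satisfying the constraints up to `1 / (k +
1)`; a limit point in the compact simplex satisfies them exactly. -/
lemma resolvabilityRegion_subset (W : X₁ → X₂ → Z → ℝ) (hW : IsChannel W) (Q : Z → ℝ)
    (hQ : Q ∈ stdSimplex ℝ Z) : resolvabilityRegion W Q ⊆ singleLetterRegion W Q := by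
  intro R hR
  obtain ⟨r, hr, hrR⟩ := mem_closure_iff_seq_limit.1 hR
  have hr₁ : Tendsto (fun k => (r k).1) atTop (𝓝 R.1) := (continuous_fst.tendsto R).comp hrR
  have hr₂ : Tendsto (fun k => (r k).2) atTop (𝓝 R.2) := (continuous_snd.tendsto R).comp hrR
  have hε : Tendsto (fun k : ℕ => 1 / ((k : ℝ) + 1)) atTop (𝓝 0) :=
    tendsto_one_div_add_atTop_nhds_zero_nat
  choose P hP h0 h1 h2 h3 using fun k : ℕ =>
    exists_dist_of_achievable W hW Q hQ (r k) (hr k) (Nat.one_div_pos_of_nat (α := ℝ) (n := k))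
  obtain ⟨P', hP', σ, hσ, hlim⟩ := (isCompact_stdSimplex ℝ (X₁ × X₂)).tendsto_subseq hP
  have hlim' : Tendsto (P ∘ σ) atTop (𝓝[stdSimplex ℝ (X₁ × X₂)] P') :=
    tendsto_nhdsWithin_iff.2 ⟨hlim, Eventually.of_forall fun k => hP (σ k)⟩
  have cj : Continuous fun P : X₁ × X₂ → ℝ => jointDist P W :=
    continuous_pi fun q => (continuous_apply q.1).mul continuous_const
  have cf : Continuous fun P : X₁ × X₂ → ℝ => jointDistFst P W :=
    continuous_pi fun q => continuous_finsetSum _ fun y _ =>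
      (continuous_apply (q.1, y)).mul continuous_const
  have co : Continuous fun P : X₁ × X₂ → ℝ => sndMarginal (jointDist P W) :=
    continuous_pi fun z => continuous_finsetSum _ fun s _ => (continuous_apply (s, z)).comp cj
  have cm : Continuous fun P : X₁ × X₂ → ℝ => fstMarginal P :=
    continuous_pi fun x => continuous_finsetSum _ fun y _ => continuous_apply (x, y)
  have cI : ContinuousOn (fun P => mutualInfo (jointDist P W)) (stdSimplex ℝ (X₁ × X₂)) :=
    continuousOn_mutualInfo.comp cj.continuousOn fun P hP q =>
      mul_nonneg (hP.1 _) ((hW _ _).1 _)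
  have cI₁ : ContinuousOn (fun P => mutualInfo (jointDistFst P W)) (stdSimplex ℝ (X₁ × X₂)) :=
    continuousOn_mutualInfo.comp cf.continuousOn fun P hP q =>
      sum_nonneg fun y _ => mul_nonneg (hP.1 _) ((hW _ _).1 _)
  have tI := (cI P' hP').tendsto.comp hlim'
  have tI₁ := (cI₁ P' hP').tendsto.comp hlim'
  have tH := ((continuous_entropy.comp cm).tendsto P').comp hlim
  have ch : Continuous fun P : X₁ × X₂ → ℝ =>
      ∑ z, (√(sndMarginal (jointDist P W) z) - √(Q z)) ^ 2 :=
    continuous_finsetSum _ fun z _ =>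
      (((continuous_apply z).comp co).sqrt.sub continuous_const).pow 2
  have th := (ch.tendsto P').comp hlim
  have sσ := hσ.tendsto_atTop
  refine ⟨ge_of_tendsto' hr₁ fun k => (hr k).1, ge_of_tendsto' hr₂ fun k => (hr k).2.1,
    P', hP', ?_, ?_, ?_, ?_⟩
  -- The Hellinger sum is continuous even where `Q` vanishes, so its limit is zero and the output
  -- law is exactly `Q`.
  · have hle := le_of_tendsto_of_tendsto' th (hε.comp sσ) fun k => h0 (σ k)
    have hz := (sum_eq_zero_iff_of_nonneg fun z _ => sq_nonneg _).1
      (hle.antisymm (sum_nonneg fun z _ => sq_nonneg _))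
    funext z
    have := sub_eq_zero.1 (pow_eq_zero_iff two_ne_zero |>.1 (hz z (mem_univ z)))
    refine (Real.sqrt_inj ?_ (hQ.1 z)).1 this
    exact sum_nonneg fun s _ => mul_nonneg (hP'.1 _) ((hW _ _).1 _)
  · have t := (hr₁.comp sσ).add (hε.comp sσ)
    rw [add_zero] at t
    exact le_of_tendsto_of_tendsto' tI₁ t fun k => h1 (σ k)
  · have t := (hr₂.comp sσ).add (hε.comp sσ)
    rw [add_zero] at t
    exact le_of_tendsto_of_tendsto' (tI.sub tH) t fun k => h2 (σ k)
  · have t := ((hr₁.comp sσ).add (hr₂.comp sσ)).add (hε.comp sσ)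
    rw [add_zero] at t
    exact le_of_tendsto_of_tendsto' tI t fun k => h3 (σ k)

end Region

end CribbingMAC

theorem theorem3 {X₁ X₂ Z : Type*} [Fintype X₁] [Fintype X₂] [Fintype Z]
    (W : X₁ → X₂ → Z → ℝ) (hW : CribbingMAC.IsChannel W)
    (Q : Z → ℝ) (hQ : Q ∈ stdSimplex ℝ Z) :
    CribbingMAC.resolvabilityRegion W Q =
      {R : ℝ × ℝ | 0 ≤ R.1 ∧ 0 ≤ R.2 ∧
        ∃ P ∈ stdSimplex ℝ (X₁ × X₂),
          CribbingMAC.sndMarginal (CribbingMAC.jointDist P W) = Q ∧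
          CribbingMAC.mutualInfo (CribbingMAC.jointDistFst P W) ≤ R.1 ∧
          CribbingMAC.mutualInfo (CribbingMAC.jointDist P W)
            - CribbingMAC.entropy (CribbingMAC.fstMarginal P) ≤ R.2 ∧
          CribbingMAC.mutualInfo (CribbingMAC.jointDist P W) ≤ R.1 + R.2} := by
  exact (CribbingMAC.resolvabilityRegion_subset W hW Q hQ).antisymm
    (CribbingMAC.singleLetterRegion_subset W hW Q hQ)
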